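/- **Lemma.** For every $\varepsilon>0$ there is a constant $c>0$ such that for every $p>0$ there is a constant $C>0$ for which the following holds. Let $M\ge 1$ be an integer, let $d$ be a real number with $2\sqrt M\le d\le M$, and let $Q_1,Q_2\subset\mathbb R^2$ be two squares of area $M$ each (of arbitrary orientation) whose centers are at Euclidean distance $d$. Let $X_1,\dots,X_M,Y_1,\dots,Y_M$ be independent random points (nodes), with each $X_j$ uniformly distributed in $Q_1$ and each $Y_k$ uniformly distributed in $Q_2$, and let $\widehat H$ be the $M\times M$ line-of-sight channel matrix between the two clusters of nodes, with entries $$\widehat h_{jk}=\frac{e^{2\pi i\, r_{jk}}}{r_{jk}},\qquad r_{jk}=|X_j-Y_k|,\qquad 1\le j,k\le M .$$ Then, with $\|\cdot\|$ denoting the spectral norm (largest singular value), $$\mathbb P\left(\|\widehat H\|^2\le c\,\frac{M^{1+\varepsilon}}{d}\right)\ \ge\ 1-\frac{C}{M^{p}} .$$ In particular, the bound $\|\widehat H\|^2\le c\,M^{1+\varepsilon}/d$ holds with high probability as $M\to\infty$, uniformly in $d$ and in the position and orientation of the two squares. -/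

import Mathlib

open MeasureTheory ProbabilityTheory

noncomputable section

/-- The Euclidean plane. -/
abbrev Plane : Type := EuclideanSpace ℝ (Fin 2)

/-- The closed square with center `o` and side length `s` whose sides are parallel to the
orthonormal directions `(cos θ, sin θ)` and `(-sin θ, cos θ)`. -/
def tiltedSquare (o : Plane) (θ s : ℝ) : Set Plane :=
  {x | |Real.cos θ * (x 0 - o 0) + Real.sin θ * (x 1 - o 1)| ≤ s / 2 ∧
       |-Real.sin θ * (x 0 - o 0) + Real.cos θ * (x 1 - o 1)| ≤ s / 2}

/-- The line-of-sight channel matrix (carrier wavelength and Friis constant normalised to `1`)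
between the transmit nodes `y k` and the receive nodes `x j`: its `(j, k)` entry is
`exp (2 π i r) / r`, where `r` is the distance between `x j` and `y k`. -/
def losMatrix {M : ℕ} (x y : Fin M → Plane) : Matrix (Fin M) (Fin M) ℂ :=
  Matrix.of fun j k =>
    Complex.exp (2 * Real.pi * Complex.I * (dist (x j) (y k) : ℂ)) / (dist (x j) (y k) : ℂ)

/-- The spectral norm (largest singular value) of a complex square matrix: its operator norm
for the Euclidean norm on `ℂ ^ M`. -/
def spectralNormOf {M : ℕ} (A : Matrix (Fin M) (Fin M) ℂ) : ℝ :=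
  ‖Matrix.toEuclideanCLM (n := Fin M) (𝕜 := ℂ) A‖

/-- `X` and `Y` are the random positions of the nodes of two square clusters of `M` nodes each:
all `2 M` positions are independent, those of the first cluster are uniform in the square of
area `M` with center `o₁` and tilt `θ₁`, those of the second one are uniform in the square of
area `M` with center `o₂` and tilt `θ₂`. -/
structure IsUniformClusterPair {Ω : Type*} [MeasurableSpace Ω] (P : Measure Ω) (M : ℕ)
    (o₁ o₂ : Plane) (θ₁ θ₂ : ℝ) (X Y : Fin M → Ω → Plane) : Prop where
  measurable_fst : ∀ j, Measurable (X j)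
  measurable_snd : ∀ k, Measurable (Y k)
  indep : iIndepFun (Sum.elim X Y) P
  uniform_fst : ∀ j, pdf.IsUniform (X j) (tiltedSquare o₁ θ₁ (Real.sqrt M)) P volume
  uniform_snd : ∀ k, pdf.IsUniform (Y k) (tiltedSquare o₂ θ₂ (Real.sqrt M)) P volume

end

/-! In a frame whose first axis joins the centres, a receiver `(a, x)` and a source `(b, t)` are at
distance `planarRadius (d + a - b) (x - t)`. Both clusters are cut along that axis into `O(√M)`
slabs of unit width, and one slab of sources is paired with one strip of receivers.

Along a transversal segment the waves of two sources of the same slab are almost orthogonal. The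
derivative of their phase difference has size `|t - t'| / d`, up to an error `O(1 / d)` due to the
longitudinal offset of at most `1`. Integration by parts therefore bounds their correlation by `K /
(d * (1 + |t - t'|))` (`IsSymbol.exists_wave_correlation_le`). If unit cells contain at most `m`
nodes, Schur's test bounds the energy on the segment by a multiple of `m * log M / d` times the
emitted energy. Receivers are points, not segments; but the wavelength is `1`, so the derivatives of
the kernel obey the same bound, and a Sobolev inequality in each coordinate passes from integrals to
points at the price of another `m` (`exists_sum_strip_wave_le`). Cauchy–Schwarz over the slabs and
summation over the strips lose a factor of order `M`, whence `‖H‖² ≲ M * m² * log M / d`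
(`exists_spectralNormOf_losMatrix_sq_le`).

Randomness enters only through `m`. A given set of `m + 1` nodes falls into a given cell with
probability at most `M ^ (-(m + 1))`, so a union bound makes the exceptional probability at most `4
* M / (m + 1)!` per cluster (`exists_event_occupancy`). For `m` of order `M ^ (ε / 4)` this is
smaller than any power of `M`, while `m² * log M ≲ M ^ ε`. -/

/-! ### Calculus of the distance function -/

/-- The distance between two points whose coordinates differ by `D` and `u`. -/
noncomputable def planarRadius (D u : ℝ) : ℝ := √(D ^ 2 + u ^ 2)

/-- The cosine of the angle between the vector `(D, u)` and the first axis. -/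
noncomputable def planarCos (D u : ℝ) : ℝ := D / planarRadius D u

/-- The sine of the angle between the vector `(D, u)` and the first axis. -/
noncomputable def planarSin (D u : ℝ) : ℝ := u / planarRadius D u

section Geometry

variable {D u : ℝ}

lemma planarRadius_pos (hD : 0 < D) (u : ℝ) : 0 < planarRadius D u :=
  Real.sqrt_pos.2 (add_pos_of_pos_of_nonneg (pow_pos hD 2) (sq_nonneg u))

lemma planarRadius_sq (D u : ℝ) : planarRadius D u ^ 2 = D ^ 2 + u ^ 2 :=
  Real.sq_sqrt (by positivity)

lemma le_planarRadius (D u : ℝ) : D ≤ planarRadius D u :=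
  Real.le_sqrt_of_sq_le (by nlinarith [sq_nonneg u])

lemma abs_le_planarRadius (D u : ℝ) : |u| ≤ planarRadius D u :=
  Real.le_sqrt_of_sq_le (by rw [sq_abs]; nlinarith [sq_nonneg D])

lemma planarCos_pos (hD : 0 < D) (u : ℝ) : 0 < planarCos D u :=
  div_pos hD (planarRadius_pos hD u)

lemma planarCos_le_one (hD : 0 < D) (u : ℝ) : planarCos D u ≤ 1 :=
  (div_le_one (planarRadius_pos hD u)).2 (le_planarRadius D u)

lemma abs_planarCos_le_one (hD : 0 < D) (u : ℝ) : |planarCos D u| ≤ 1 := by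
  rw [abs_of_pos (planarCos_pos hD u)]; exact planarCos_le_one hD u

lemma abs_planarSin_le_one (hD : 0 < D) (u : ℝ) : |planarSin D u| ≤ 1 := by
  rw [planarSin, abs_div, abs_of_pos (planarRadius_pos hD u)]
  exact (div_le_one (planarRadius_pos hD u)).2 (abs_le_planarRadius D u)

lemma hasDerivAt_planarRadius_snd (hD : 0 < D) (u : ℝ) :
    HasDerivAt (planarRadius D) (planarSin D u) u := by
  have h : HasDerivAt (fun u : ℝ => D ^ 2 + u ^ 2) (2 * u) u := by
    simpa using ((hasDerivAt_id u).pow 2).const_add (D ^ 2)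
  have h2 := h.sqrt (by positivity)
  refine h2.congr_deriv ?_
  rw [planarSin, planarRadius]
  field_simp

lemma hasDerivAt_planarRadius_fst (hD : 0 < D) (u : ℝ) :
    HasDerivAt (fun D => planarRadius D u) (planarCos D u) D := by
  have h : HasDerivAt (fun D : ℝ => D ^ 2 + u ^ 2) (2 * D) D := by
    simpa using ((hasDerivAt_id D).pow 2).add_const (u ^ 2)
  have h2 := h.sqrt (by positivity)
  refine h2.congr_deriv ?_
  rw [planarCos, planarRadius]
  field_simp

lemma hasDerivAt_planarCos_snd (hD : 0 < D) (u : ℝ) :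
    HasDerivAt (planarCos D) (-(planarCos D u ^ 2 * planarSin D u) / D) u := by
  have hR := planarRadius_pos hD u
  have h := (hasDerivAt_const u D).div (hasDerivAt_planarRadius_snd hD u) hR.ne'
  refine h.congr_deriv ?_
  rw [planarCos, planarSin]
  field_simp
  ring

lemma hasDerivAt_planarSin_snd (hD : 0 < D) (u : ℝ) :
    HasDerivAt (planarSin D) (planarCos D u ^ 3 / D) u := by
  have hR := planarRadius_pos hD u
  have h := (hasDerivAt_id u).div (hasDerivAt_planarRadius_snd hD u) hR.ne'
  refine h.congr_deriv ?_
  rw [planarCos, planarSin]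
  have := planarRadius_sq D u
  simp only [id]
  field_simp
  linear_combination this

lemma hasDerivAt_planarSin_fst (hD : 0 < D) (u : ℝ) :
    HasDerivAt (fun D => planarSin D u) (-(planarSin D u * planarCos D u ^ 2) / D) D := by
  have hR := planarRadius_pos hD u
  have h := (hasDerivAt_const D u).div (hasDerivAt_planarRadius_fst hD u) hR.ne'
  refine h.congr_deriv ?_
  rw [planarCos, planarSin]
  field_simp
  ring

lemma hasDerivAt_planarCos_fst (hD : 0 < D) (u : ℝ) :
    HasDerivAt (fun D => planarCos D u) (planarSin D u ^ 2 * planarCos D u / D) D := by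
  have hR := planarRadius_pos hD u
  have h := (hasDerivAt_id D).div (hasDerivAt_planarRadius_fst hD u) hR.ne'
  refine h.congr_deriv ?_
  rw [planarCos, planarSin]
  have := planarRadius_sq D u
  simp only [id]
  field_simp
  linear_combination this

lemma contDiff_planarRadius (hD : 0 < D) {n : WithTop ℕ∞} : ContDiff ℝ n (planarRadius D) := by
  unfold planarRadius
  refine ContDiff.sqrt (by fun_prop) fun u => ?_
  positivity

lemma contDiff_planarCos (hD : 0 < D) {n : WithTop ℕ∞} : ContDiff ℝ n (planarCos D) :=
  contDiff_const.div (contDiff_planarRadius hD) fun u => (planarRadius_pos hD u).ne'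

lemma contDiff_planarSin (hD : 0 < D) {n : WithTop ℕ∞} : ContDiff ℝ n (planarSin D) :=
  contDiff_id.div (contDiff_planarRadius hD) fun u => (planarRadius_pos hD u).ne'

end Geometry

/-! ### Symbols, waves and the derivatives of the kernel -/

/-- Symbols of order `0`: families of amplitudes bounded uniformly in `D ≥ 1`, each derivative in
the second variable gaining a factor `1 / D`. -/
def IsSymbol (A : ℝ → ℝ → ℂ) : Prop :=
  ∃ C : ℝ, 0 ≤ C ∧ ∀ D : ℝ, 1 ≤ D → ContDiff ℝ 1 (A D) ∧
    ∀ u, ‖A D u‖ ≤ C ∧ ‖deriv (A D) u‖ ≤ C / D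

namespace IsSymbol

variable {A B : ℝ → ℝ → ℂ}

lemma mul (hA : IsSymbol A) (hB : IsSymbol B) : IsSymbol fun D u => A D u * B D u := by
  obtain ⟨C, hC, hA⟩ := hA
  obtain ⟨C', hC', hB⟩ := hB
  refine ⟨2 * (C * C'), by positivity, fun D hD => ⟨(hA D hD).1.mul (hB D hD).1, fun u => ?_⟩⟩
  obtain ⟨h1, h2⟩ := (hA D hD).2 u
  obtain ⟨h3, h4⟩ := (hB D hD).2 u
  have hD0 : 0 < D := by linarith
  constructor
  · rw [norm_mul]
    nlinarith [mul_le_mul h1 h3 (norm_nonneg _) hC, mul_nonneg hC hC']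
  · rw [deriv_fun_mul ((hA D hD).1.differentiable one_ne_zero u)
      ((hB D hD).1.differentiable one_ne_zero u)]
    calc _ ≤ ‖deriv (A D) u‖ * ‖B D u‖ + ‖A D u‖ * ‖deriv (B D) u‖ := by
          simpa only [norm_mul] using norm_add_le (deriv (A D) u * B D u) (A D u * deriv (B D) u)
      _ ≤ C / D * C' + C * (C' / D) := by gcongr
      _ = _ := by ring

lemma add (hA : IsSymbol A) (hB : IsSymbol B) : IsSymbol fun D u => A D u + B D u := by
  obtain ⟨C, hC, hA⟩ := hA
  obtain ⟨C', hC', hB⟩ := hB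
  refine ⟨C + C', by positivity, fun D hD => ⟨(hA D hD).1.add (hB D hD).1, fun u => ?_⟩⟩
  obtain ⟨h1, h2⟩ := (hA D hD).2 u
  obtain ⟨h3, h4⟩ := (hB D hD).2 u
  constructor
  · exact (norm_add_le _ _).trans (add_le_add h1 h3)
  · rw [deriv_fun_add ((hA D hD).1.differentiable one_ne_zero u)
      ((hB D hD).1.differentiable one_ne_zero u), add_div]
    exact (norm_add_le _ _).trans (add_le_add h2 h4)

lemma const (z : ℂ) : IsSymbol fun _ _ => z :=
  ⟨‖z‖, norm_nonneg z, fun D hD => ⟨contDiff_const, fun u => ⟨le_rfl, by simp; positivity⟩⟩⟩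

lemma inv : IsSymbol fun D _ => (D : ℂ)⁻¹ :=
  ⟨1, zero_le_one, fun D hD => ⟨contDiff_const, fun u =>
    ⟨by simpa [abs_of_nonneg (zero_le_one.trans hD)] using inv_le_one_of_one_le₀ hD,
      by simp; positivity⟩⟩⟩

lemma cos : IsSymbol fun D u => (planarCos D u : ℂ) := by
  refine ⟨1, zero_le_one, fun D hD => ⟨?_, fun u => ?_⟩⟩
  · exact Complex.ofRealCLM.contDiff.comp (contDiff_planarCos (by linarith))
  have hD0 : 0 < D := by linarith
  constructor
  · simpa using abs_planarCos_le_one hD0 u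
  · rw [(hasDerivAt_planarCos_snd hD0 u).ofReal_comp.deriv, Complex.norm_real, Real.norm_eq_abs,
      abs_div, abs_neg, abs_mul, abs_pow, abs_of_pos hD0]
    gcongr
    exact mul_le_one₀ (pow_le_one₀ (abs_nonneg _) (abs_planarCos_le_one hD0 u)) (abs_nonneg _)
      (abs_planarSin_le_one hD0 u)

lemma sin : IsSymbol fun D u => (planarSin D u : ℂ) := by
  refine ⟨1, zero_le_one, fun D hD => ⟨?_, fun u => ?_⟩⟩
  · exact Complex.ofRealCLM.contDiff.comp (contDiff_planarSin (by linarith))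
  have hD0 : 0 < D := by linarith
  constructor
  · simpa using abs_planarSin_le_one hD0 u
  · rw [(hasDerivAt_planarSin_snd hD0 u).ofReal_comp.deriv, Complex.norm_real, Real.norm_eq_abs,
      abs_div, abs_pow, abs_of_pos hD0]
    gcongr
    exact pow_le_one₀ (abs_nonneg _) (abs_planarCos_le_one hD0 u)

end IsSymbol

/-- The wave with phase `2 π` times the distance and with amplitude `A / D`. -/
noncomputable def wave (A : ℝ → ℝ → ℂ) (D u : ℝ) : ℂ :=
  Complex.exp (2 * Real.pi * Complex.I * (planarRadius D u : ℂ)) * (A D u / D)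

/-- The amplitude of the line-of-sight kernel. -/
noncomputable def losAmp (D u : ℝ) : ℂ := planarCos D u

/-- The amplitude of the transversal derivative of the line-of-sight kernel. -/
noncomputable def losAmpSnd (D u : ℝ) : ℂ :=
  planarCos D u * planarSin D u * (2 * Real.pi * Complex.I + (-1) * (planarCos D u * (D : ℂ)⁻¹))

/-- The amplitude of the longitudinal derivative of the line-of-sight kernel. -/
noncomputable def losAmpFst (D u : ℝ) : ℂ :=
  planarCos D u * planarCos D u * (2 * Real.pi * Complex.I + (-1) * (planarCos D u * (D : ℂ)⁻¹))

/-- The amplitude of the mixed derivative of the line-of-sight kernel. -/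
noncomputable def losAmpMixed (D u : ℝ) : ℂ :=
  planarCos D u * planarCos D u * planarSin D u *
    ((2 * Real.pi * Complex.I) * (2 * Real.pi * Complex.I) +
      ((-3) * (2 * Real.pi * Complex.I) * (planarCos D u * (D : ℂ)⁻¹) +
      3 * (planarCos D u * (D : ℂ)⁻¹) * (planarCos D u * (D : ℂ)⁻¹)))

lemma isSymbol_losAmp : IsSymbol losAmp := .cos

/-- Differentiating the phase costs only the constant `2 π` times a sine or cosine, so derivatives
of the kernel remain of order `0`. The amplitudes are written as sums and products of elementary
symbols, signs included as constant factors, to follow the closure rules. -/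
lemma isSymbol_losAmpSnd : IsSymbol losAmpSnd :=
  (IsSymbol.cos.mul .sin).mul ((IsSymbol.const _).add ((IsSymbol.const _).mul (IsSymbol.cos.mul .inv)))

lemma isSymbol_losAmpFst : IsSymbol losAmpFst :=
  (IsSymbol.cos.mul .cos).mul ((IsSymbol.const _).add ((IsSymbol.const _).mul (IsSymbol.cos.mul .inv)))

lemma isSymbol_losAmpMixed : IsSymbol losAmpMixed :=
  ((IsSymbol.cos.mul .cos).mul .sin).mul (((IsSymbol.const _).mul (IsSymbol.const _)).add
    (((IsSymbol.const _).mul (IsSymbol.cos.mul .inv)).add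
      (((IsSymbol.const _).mul (IsSymbol.cos.mul .inv)).mul (IsSymbol.cos.mul .inv))))

section Derivatives

variable {D : ℝ}

lemma wave_losAmp (hD : 0 < D) (u : ℝ) :
    wave losAmp D u = Complex.exp (2 * Real.pi * Complex.I * (planarRadius D u : ℂ)) /
      (planarRadius D u : ℂ) := by
  have hR : (planarRadius D u : ℂ) ≠ 0 := by exact_mod_cast (planarRadius_pos hD u).ne'
  have hD' : (D : ℂ) ≠ 0 := by exact_mod_cast hD.ne'
  rw [wave, losAmp, planarCos]
  push_cast
  field_simp

lemma hasDerivAt_wave_losAmp_snd (hD : 0 < D) (u : ℝ) :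
    HasDerivAt (wave losAmp D) (wave losAmpSnd D u) u := by
  have hD' : (D : ℂ) ≠ 0 := by exact_mod_cast hD.ne'
  have h1 := ((hasDerivAt_planarRadius_snd hD u).ofReal_comp.const_mul
    (2 * Real.pi * Complex.I)).cexp
  have h2 := (hasDerivAt_planarCos_snd hD u).ofReal_comp.div_const (D : ℂ)
  refine (h1.mul h2).congr_deriv ?_
  simp only [wave, losAmpSnd]
  push_cast
  field_simp

lemma hasDerivAt_wave_losAmpFst_snd (hD : 0 < D) (u : ℝ) :
    HasDerivAt (wave losAmpFst D) (wave losAmpMixed D u) u := by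
  have hD' : (D : ℂ) ≠ 0 := by exact_mod_cast hD.ne'
  have h1 := ((hasDerivAt_planarRadius_snd hD u).ofReal_comp.const_mul
    (2 * Real.pi * Complex.I)).cexp
  have h2 := (hasDerivAt_planarCos_snd hD u).ofReal_comp
  have h3 := ((h2.mul h2).mul (((h2.mul_const (D : ℂ)⁻¹).const_mul (-1)).const_add
    (2 * Real.pi * Complex.I))).div_const (D : ℂ)
  refine (h1.mul h3).congr_deriv ?_
  simp only [wave, losAmpMixed]
  push_cast
  simp only [Pi.mul_apply]
  field_simp
  ring

lemma hasDerivAt_wave_losAmp_fst (hD : 0 < D) (u : ℝ) :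
    HasDerivAt (fun D => wave losAmp D u) (wave losAmpFst D u) D := by
  have hD' : (D : ℂ) ≠ 0 := by exact_mod_cast hD.ne'
  have h1 := ((hasDerivAt_planarRadius_fst hD u).ofReal_comp.const_mul
    (2 * Real.pi * Complex.I)).cexp
  have h2 := (hasDerivAt_planarCos_fst hD u).ofReal_comp.div (hasDerivAt_id D).ofReal_comp hD'
  refine (h1.mul h2).congr_deriv ?_
  -- The derivative of `cos / D` in `D` is `(sin² * cos - cos) / D²`, which this identity turns into
  -- `-cos³ / D²`.
  have h3 : (planarSin D u : ℂ) ^ 2 + (planarCos D u : ℂ) ^ 2 = 1 := by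
    have hR := planarRadius_pos hD u
    have : planarSin D u ^ 2 + planarCos D u ^ 2 = 1 := by
      rw [planarSin, planarCos]
      have := planarRadius_sq D u
      field_simp
      linarith
    exact_mod_cast this
  simp only [wave, losAmpFst, Pi.div_apply]
  push_cast
  simp only [id]
  field_simp
  linear_combination (planarCos D u : ℂ) * h3

lemma contDiff_wave {A : ℝ → ℝ → ℂ} (hD : 1 ≤ D) (hA : IsSymbol A) :
    ContDiff ℝ 1 (wave A D) := by
  obtain ⟨C, -, hA⟩ := hA
  have h1 : ContDiff ℝ 1 fun u => (planarRadius D u : ℂ) :=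
    Complex.ofRealCLM.contDiff.comp (contDiff_planarRadius (by linarith))
  have h2 := (hA D hD).1
  unfold wave
  exact ((contDiff_const.mul h1).cexp).mul (h2.div_const _)

end Derivatives

/-! ### Oscillatory integrals and almost orthogonality -/

/-- The first derivative test for oscillatory integrals. -/
lemma norm_integral_exp_mul_le {α β l κ b₀ b₁ : ℝ} (hαβ : α ≤ β) (hl : 0 < l) (hb₀ : 0 ≤ b₀)
    (hb₁ : 0 ≤ b₁) {ψ ψ₁ ψ₂ : ℝ → ℝ} {B : ℝ → ℂ} (hψ : ∀ s, HasDerivAt ψ (ψ₁ s) s)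
    (hψ₁ : ∀ s, HasDerivAt ψ₁ (ψ₂ s) s) (hψ₂ : Continuous ψ₂) (hB : ContDiff ℝ 1 B)
    (h1 : ∀ s ∈ Set.Icc α β, l ≤ |ψ₁ s|) (h2 : ∀ s ∈ Set.Icc α β, |ψ₂ s| ≤ κ)
    (h3 : ∀ s ∈ Set.Icc α β, ‖B s‖ ≤ b₀) (h4 : ∀ s ∈ Set.Icc α β, ‖deriv B s‖ ≤ b₁) :
    ‖∫ s in α..β, Complex.exp (2 * Real.pi * Complex.I * (ψ s : ℂ)) * B s‖ ≤
      2 * (b₀ / l) + (b₁ / l + b₀ * κ / l ^ 2) * (β - α) := by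
  set c : ℂ := 2 * Real.pi * Complex.I with hc
  have hc1 : 1 ≤ ‖c‖ := by
    simp only [hc, norm_mul, Complex.norm_ofNat, Complex.norm_real, Complex.norm_I, mul_one,
      Real.norm_eq_abs, abs_of_pos Real.pi_pos]
    linarith [Real.pi_gt_three]
  have hc0 : c ≠ 0 := norm_pos_iff.1 (by linarith)
  have hci : ‖c⁻¹‖ ≤ 1 := by rw [norm_inv]; exact inv_le_one_of_one_le₀ hc1
  have hne : ∀ s ∈ Set.Icc α β, (ψ₁ s : ℂ) ≠ 0 := fun s hs h => by
    have := h1 s hs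
    rw [Complex.ofReal_eq_zero.1 h, abs_zero] at this
    linarith
  set E : ℝ → ℂ := fun s => Complex.exp (c * (ψ s : ℂ)) with hE
  have hEn : ∀ s, ‖E s‖ = 1 := fun s => by
    simp only [hE, hc]
    rw [show 2 * (Real.pi : ℂ) * Complex.I * (ψ s : ℂ) = ((2 * Real.pi * ψ s : ℝ) : ℂ) * Complex.I by
      push_cast; ring]
    exact Complex.norm_exp_ofReal_mul_I _
  -- Since `E' = c * ψ₁ * E`, the integrand is `w * E'`. Integration by parts leaves two boundary
  -- terms of size `b₀ / l` and the integral of `w' * E`; the factor `‖c⁻¹‖ ≤ 1` is discarded.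
  set w : ℝ → ℂ := fun s => c⁻¹ * (B s * (ψ₁ s : ℂ)⁻¹) with hw
  set w' : ℝ → ℂ := fun s => c⁻¹ * (deriv B s * (ψ₁ s : ℂ)⁻¹ + B s * (-(ψ₂ s : ℂ) / (ψ₁ s : ℂ) ^ 2))
    with hw'
  have hcψ₁ : Continuous fun s => (ψ₁ s : ℂ) := Complex.continuous_ofReal.comp
    (continuous_iff_continuousAt.2 fun s => (hψ₁ s).continuousAt)
  have hcψ : Continuous fun s => (ψ s : ℂ) := Complex.continuous_ofReal.comp
    (continuous_iff_continuousAt.2 fun s => (hψ s).continuousAt)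
  have hcψ₂ : Continuous fun s => (ψ₂ s : ℂ) := Complex.continuous_ofReal.comp hψ₂
  have hcE : Continuous E := (continuous_const.mul hcψ).cexp
  have hBd : Continuous (deriv B) := hB.continuous_deriv le_rfl
  have hdE : ∀ s, HasDerivAt E (E s * (c * (ψ₁ s : ℂ))) s := fun s =>
    ((hψ s).ofReal_comp.const_mul c).cexp
  have hdw : ∀ s ∈ Set.Icc α β, HasDerivAt w (w' s) s := fun s hs =>
    (((hB.differentiable one_ne_zero s).hasDerivAt.mul
      ((hψ₁ s).ofReal_comp.inv (hne s hs))).const_mul c⁻¹)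
  have hcw' : ContinuousOn w' (Set.Icc α β) := by
    refine continuousOn_const.mul (.add (.mul hBd.continuousOn (hcψ₁.continuousOn.inv₀ hne))
      (.mul hB.continuous.continuousOn (.div hcψ₂.neg.continuousOn (hcψ₁.continuousOn.pow 2) ?_)))
    exact fun s hs => pow_ne_zero _ (hne s hs)
  have hu : Set.uIcc α β = Set.Icc α β := Set.uIcc_of_le hαβ
  have hibp := intervalIntegral.integral_mul_deriv_eq_deriv_mul (a := α) (b := β) (u := w) (v := E)
    (u' := w') (v' := fun s => E s * (c * (ψ₁ s : ℂ))) (fun s hs => hdw s (hu ▸ hs))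
    (fun s _ => hdE s) (hcw'.intervalIntegrable_of_Icc hαβ)
    ((hcE.mul (continuous_const.mul hcψ₁)).intervalIntegrable _ _)
  have hI : ∫ s in α..β, E s * B s = ∫ s in α..β, w s * (E s * (c * (ψ₁ s : ℂ))) := by
    refine intervalIntegral.integral_congr fun s hs => ?_
    have := hne s (hu ▸ hs)
    simp only [hw]
    field_simp
  have hψi : ∀ s ∈ Set.Icc α β, ‖(ψ₁ s : ℂ)⁻¹‖ ≤ l⁻¹ := fun s hs => by
    rw [norm_inv, Complex.norm_real, Real.norm_eq_abs]
    exact inv_anti₀ hl (h1 s hs)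
  have hwb : ∀ s ∈ Set.Icc α β, ‖w s * E s‖ ≤ b₀ / l := fun s hs => by
    rw [norm_mul, hEn, mul_one, norm_mul, norm_mul]
    calc _ ≤ 1 * (b₀ * l⁻¹) := by gcongr; exacts [h3 s hs, hψi s hs]
      _ = _ := by ring
  have hwb' : ∀ s ∈ Set.Icc α β, ‖w' s * E s‖ ≤ b₁ / l + b₀ * κ / l ^ 2 := fun s hs => by
    rw [norm_mul, hEn, mul_one, norm_mul]
    have hκ : 0 ≤ κ := (abs_nonneg _).trans (h2 s hs)
    have e1 : ‖deriv B s * (ψ₁ s : ℂ)⁻¹‖ ≤ b₁ * l⁻¹ := by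
      rw [norm_mul]; gcongr; exacts [h4 s hs, hψi s hs]
    have e2 : ‖B s * (-(ψ₂ s : ℂ) / (ψ₁ s : ℂ) ^ 2)‖ ≤ b₀ * (κ * l⁻¹ ^ 2) := by
      rw [norm_mul, div_eq_mul_inv, norm_mul, norm_neg, ← inv_pow, norm_pow, Complex.norm_real,
        Real.norm_eq_abs]
      gcongr
      exacts [h3 s hs, h2 s hs, hψi s hs]
    calc _ ≤ 1 * (b₁ * l⁻¹ + b₀ * (κ * l⁻¹ ^ 2)) := by
          gcongr
          exact (norm_add_le _ _).trans (add_le_add e1 e2)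
      _ = _ := by rw [inv_pow]; ring
  change ‖∫ s in α..β, E s * B s‖ ≤ _
  rw [hI, hibp]
  have hint := intervalIntegral.norm_integral_le_of_norm_le_const (a := α) (b := β)
    (f := fun s => w' s * E s) fun s hs => hwb' s
      (Set.Ioc_subset_Icc_self (by rwa [Set.uIoc_of_le hαβ] at hs))
  rw [abs_of_nonneg (sub_nonneg.2 hαβ)] at hint
  have hβ := hwb β (Set.right_mem_Icc.2 hαβ)
  have hα := hwb α (Set.left_mem_Icc.2 hαβ)
  calc _ ≤ ‖w β * E β‖ + ‖w α * E α‖ + ‖∫ s in α..β, w' s * E s‖ :=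
        (norm_sub_le _ _).trans (by gcongr; exact norm_sub_le _ _)
    _ ≤ _ := by linarith

section Phase

variable {d D D' u u' : ℝ}

lemma planarRadius_le (hd : 0 < d) (hD : 0 < D) (hD2 : D ≤ 2 * d) (hu : |u| ≤ 2 * d) :
    planarRadius D u ≤ 3 * d := by
  refine Real.sqrt_le_iff.2 ⟨by positivity, ?_⟩
  nlinarith [sq_abs u, abs_nonneg u]

/-- The quantity is `D² / R³`, and `1728 = 8² * 3³` comes from `D ≥ d / 8` and `R ≤ 3 * d`. Being
the transversal derivative of the sine, it makes the phase derivatives of two sources separate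
linearly. -/
lemma le_planarCos_pow_three_div (hd : 0 < d) (hD : d / 8 ≤ D) (hD2 : D ≤ 2 * d)
    (hu : |u| ≤ 2 * d) : 1 / (1728 * d) ≤ planarCos D u ^ 3 / D := by
  have hD0 : 0 < D := by linarith
  have hR := planarRadius_pos hD0 u
  have hR3 := planarRadius_le hd hD0 hD2 hu
  have : planarCos D u ^ 3 / D = D ^ 2 / planarRadius D u ^ 3 := by
    rw [planarCos]; field_simp
  rw [this]
  calc 1 / (1728 * d) = (d / 8) ^ 2 / (3 * d) ^ 3 := by field_simp; norm_num
    _ ≤ _ := by gcongr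

lemma abs_planarSin_sub_snd (hd : 0 < d) (hD : d / 8 ≤ D) (hD2 : D ≤ 2 * d)
    (hu : |u| ≤ 2 * d) (hu' : |u'| ≤ 2 * d) :
    |u - u'| / (1728 * d) ≤ |planarSin D u - planarSin D u'| := by
  have hD0 : 0 < D := by linarith
  have key : ∀ x ∈ Set.Icc (-(2 * d)) (2 * d), ∀ y ∈ Set.Icc (-(2 * d)) (2 * d), x ≤ y →
      1 / (1728 * d) * (y - x) ≤ planarSin D y - planarSin D x := by
    refine (convex_Icc _ _).mul_sub_le_image_sub_of_le_deriv
      (contDiff_planarSin (n := 1) hD0).continuous.continuousOn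
      ((contDiff_planarSin (n := 1) hD0).differentiable one_ne_zero).differentiableOn fun x hx => ?_
    rw [(hasDerivAt_planarSin_snd hD0 x).deriv]
    exact le_planarCos_pow_three_div hd hD hD2 (abs_le.2 (Set.mem_Icc.1 (interior_subset hx)))
  have hm : 0 ≤ 1 / (1728 * d) := by positivity
  rcases le_total u u' with h | h
  · have := key u (abs_le.1 hu) u' (abs_le.1 hu') h
    rw [abs_of_nonpos (sub_nonpos.2 h), abs_sub_comm]
    refine le_trans (le_of_eq ?_) (this.trans (le_abs_self _))
    ring
  · have := key u' (abs_le.1 hu') u (abs_le.1 hu) h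
    rw [abs_of_nonneg (sub_nonneg.2 h)]
    refine le_trans (le_of_eq ?_) (this.trans (le_abs_self _))
    ring

lemma abs_planarSin_sub_fst (hd : 0 < d) (hD : d / 8 ≤ D) (hD' : d / 8 ≤ D') (u : ℝ) :
    |planarSin D u - planarSin D' u| ≤ 8 / d * |D - D'| := by
  refine (convex_Ici (d / 8)).norm_image_sub_le_of_norm_hasDerivWithin_le
    (f := fun D => planarSin D u)
    (fun x hx => (hasDerivAt_planarSin_fst (by linarith [Set.mem_Ici.1 hx]) u).hasDerivWithinAt)
    (fun x hx => ?_) hD' hD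
  have hx' : d / 8 ≤ x := hx
  have hx0 : 0 < x := by linarith
  rw [Real.norm_eq_abs, abs_div, abs_neg, abs_mul, abs_pow, abs_of_pos hx0]
  calc _ ≤ 1 * 1 ^ 2 / (d / 8) := by
        gcongr
        exacts [abs_planarSin_le_one hx0 u, abs_planarCos_le_one hx0 u]
    _ = _ := by field_simp

/-- The factor `|u - u'|` matters: in the first derivative test `κ / l ^ 2` must decay like the
inverse of the separation. -/
lemma abs_planarCos_pow_sub_snd (hd : 0 < d) (hD : d / 8 ≤ D) (u u' : ℝ) :
    |planarCos D u ^ 3 / D - planarCos D u' ^ 3 / D| ≤ 192 / d ^ 2 * |u - u'| := by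
  have hD0 : 0 < D := by linarith
  refine convex_univ.norm_image_sub_le_of_norm_hasDerivWithin_le
    (f := fun u => planarCos D u ^ 3 / D)
    (fun x _ => (((hasDerivAt_planarCos_snd hD0 x).pow 3).div_const D).hasDerivWithinAt)
    (fun x _ => ?_) (Set.mem_univ _) (Set.mem_univ _)
  have : (↑(3 : ℕ) * planarCos D x ^ (3 - 1) * (-(planarCos D x ^ 2 * planarSin D x) / D)) / D =
      -(3 * planarCos D x ^ 4 * planarSin D x) / D ^ 2 := by
    push_cast; field_simp
  rw [this, Real.norm_eq_abs, abs_div, abs_neg, abs_mul, abs_mul, abs_pow, abs_pow,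
    abs_of_pos hD0, abs_of_pos (three_pos : (0 : ℝ) < 3)]
  calc _ ≤ 3 * 1 ^ 4 * 1 / (d / 8) ^ 2 := by
        gcongr
        exacts [abs_planarCos_le_one hD0 x, abs_planarSin_le_one hD0 x]
    _ = _ := by field_simp; norm_num

lemma abs_planarCos_pow_sub_fst (hd : 0 < d) (hD : d / 8 ≤ D) (hD' : d / 8 ≤ D') (u : ℝ) :
    |planarCos D u ^ 3 / D - planarCos D' u ^ 3 / D'| ≤ 256 / d ^ 2 * |D - D'| := by
  refine (convex_Ici (d / 8)).norm_image_sub_le_of_norm_hasDerivWithin_le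
    (f := fun D => planarCos D u ^ 3 / D)
    (fun x hx => (((hasDerivAt_planarCos_fst (by linarith [Set.mem_Ici.1 hx]) u).pow 3).div
      (hasDerivAt_id x) (by have := Set.mem_Ici.1 hx; simp only [id]; linarith)).hasDerivWithinAt)
    (fun x hx => ?_) hD' hD
  have hx' : d / 8 ≤ x := hx
  have hx0 : 0 < x := by linarith
  have : (↑(3 : ℕ) * planarCos x u ^ (3 - 1) * (planarSin x u ^ 2 * planarCos x u / x) * id x -
      planarCos x u ^ 3 * 1) / id x ^ 2 =
      (3 * planarCos x u ^ 3 * planarSin x u ^ 2 - planarCos x u ^ 3) / x ^ 2 := by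
    push_cast; simp only [id]; field_simp
  rw [Pi.pow_apply, this, Real.norm_eq_abs, abs_div, abs_pow x, abs_of_pos hx0]
  have h1 : |3 * planarCos x u ^ 3 * planarSin x u ^ 2 - planarCos x u ^ 3| ≤ 4 := by
    have e1 : |planarCos x u ^ 3| ≤ 1 := by
      rw [abs_pow]; exact pow_le_one₀ (abs_nonneg _) (abs_planarCos_le_one hx0 u)
    have e2 : |planarSin x u ^ 2| ≤ 1 := by
      rw [abs_pow]; exact pow_le_one₀ (abs_nonneg _) (abs_planarSin_le_one hx0 u)
    have e3 : |planarCos x u ^ 3 * planarSin x u ^ 2| ≤ 1 := by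
      rw [abs_mul]; exact mul_le_one₀ e1 (abs_nonneg _) e2
    rw [abs_le] at *
    constructor <;> nlinarith
  calc _ ≤ 4 / (d / 8) ^ 2 := by gcongr
    _ = _ := by field_simp; norm_num

end Phase

/-- Almost orthogonality of the waves emitted by two sources at a transversal distance
`|t - t'|` and at a longitudinal distance at most `1`. -/
lemma IsSymbol.exists_wave_correlation_le {A : ℝ → ℝ → ℂ} (hA : IsSymbol A) :
    ∃ K : ℝ, 0 ≤ K ∧ ∀ d D D' t t' α β : ℝ, 8 ≤ d → d / 8 ≤ D → D ≤ 2 * d → d / 8 ≤ D' →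
      D' ≤ 2 * d → |D - D'| ≤ 1 → α ≤ β → β - α ≤ 2 * d → (∀ s ∈ Set.Icc α β, |s - t| ≤ 2 * d) →
      (∀ s ∈ Set.Icc α β, |s - t'| ≤ 2 * d) →
      ‖∫ s in α..β, wave A D (s - t) * starRingEnd ℂ (wave A D' (s - t'))‖ ≤
        K / (d * (1 + |t - t'|)) := by
  obtain ⟨C, hC, hA⟩ := hA
  -- The three terms are the boundary, amplitude and curvature contributions of the first derivative
  -- test with the parameters chosen below. `2 * N` allows replacing `x` by `(1 + x) / 2`, and `128
  -- * 27649` is the trivial bound for `x ≤ 27648`.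
  set N : ℝ := 128 * 3456 + 2 * 1024 * 3456 + 128 * 448 * 3456 ^ 2 with hN
  refine ⟨(2 * N + 128 * 27649) * C ^ 2, by positivity, ?_⟩
  intro d D D' t t' α β hd hD hD2 hD' hD2' hDD hαβ hlen ht ht'
  have hd0 : 0 < d := by linarith
  have hD1 : 1 ≤ D := by linarith
  have hD1' : 1 ≤ D' := by linarith
  have hD0 : 0 < D := by linarith
  have hD0' : 0 < D' := by linarith
  set f : ℝ → ℂ := fun s => A D (s - t) / D with hf
  set g : ℝ → ℂ := fun s => A D' (s - t') / D' with hg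
  set B : ℝ → ℂ := fun s => f s * starRingEnd ℂ (g s) with hB
  have bound : ∀ (E : ℝ), d / 8 ≤ E → ∀ z : ℂ, ‖z‖ ≤ C → ‖z / E‖ ≤ 8 * C / d := by
    intro E hE z hz
    have : 0 < E := by linarith
    rw [norm_div, Complex.norm_real, Real.norm_eq_abs, abs_of_pos this]
    calc _ ≤ C / (d / 8) := by gcongr
      _ = _ := by field_simp
  have bound' : ∀ (E : ℝ), d / 8 ≤ E → ∀ z : ℂ, ‖z‖ ≤ C / E → ‖z / E‖ ≤ 64 * C / d ^ 2 := by
    intro E hE z hz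
    have : 0 < E := by linarith
    rw [norm_div, Complex.norm_real, Real.norm_eq_abs, abs_of_pos this]
    calc _ ≤ C / (d / 8) / (d / 8) := by
          gcongr
          exact hz.trans (by gcongr)
      _ = _ := by field_simp; norm_num
  have hdf : ∀ s, HasDerivAt f (deriv (A D) (s - t) / D) s := fun s =>
    ((((hA D hD1).1.differentiable one_ne_zero (s - t)).hasDerivAt).comp_sub_const s t).div_const _
  have hdg : ∀ s, HasDerivAt g (deriv (A D') (s - t') / D') s := fun s =>
    ((((hA D' hD1').1.differentiable one_ne_zero (s - t')).hasDerivAt).comp_sub_const s t').div_const _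
  have hfb : ∀ s, ‖f s‖ ≤ 8 * C / d := fun s => bound D hD _ ((hA D hD1).2 _).1
  have hgb : ∀ s, ‖g s‖ ≤ 8 * C / d := fun s => bound D' hD' _ ((hA D' hD1').2 _).1
  have hfb' : ∀ s, ‖deriv (A D) (s - t) / D‖ ≤ 64 * C / d ^ 2 := fun s =>
    bound' D hD _ ((hA D hD1).2 _).2
  have hgb' : ∀ s, ‖deriv (A D') (s - t') / D'‖ ≤ 64 * C / d ^ 2 := fun s =>
    bound' D' hD' _ ((hA D' hD1').2 _).2
  have hfc : ContDiff ℝ 1 f := ((hA D hD1).1.comp (contDiff_id.sub contDiff_const)).div_const _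
  have hgc : ContDiff ℝ 1 g := ((hA D' hD1').1.comp (contDiff_id.sub contDiff_const)).div_const _
  have hBc : ContDiff ℝ 1 B := hfc.mul (Complex.conjCLE.contDiff.comp hgc)
  have hBb : ∀ s, ‖B s‖ ≤ 64 * C ^ 2 / d ^ 2 := fun s => by
    rw [hB, norm_mul, RCLike.norm_conj]
    calc _ ≤ (8 * C / d) * (8 * C / d) :=
          mul_le_mul (hfb s) (hgb s) (norm_nonneg _) (by positivity)
      _ = _ := by ring
  have hBb' : ∀ s, ‖deriv B s‖ ≤ 1024 * C ^ 2 / d ^ 3 := fun s => by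
    have hd : HasDerivAt B (deriv (A D) (s - t) / D * starRingEnd ℂ (g s) +
        f s * starRingEnd ℂ (deriv (A D') (s - t') / D')) s :=
      (hdf s).mul (hdg s).star
    rw [hd.deriv]
    calc _ ≤ ‖deriv (A D) (s - t) / D‖ * ‖g s‖ + ‖f s‖ * ‖deriv (A D') (s - t') / D'‖ := by
          refine (norm_add_le _ _).trans (le_of_eq ?_)
          rw [norm_mul, norm_mul, RCLike.norm_conj, RCLike.norm_conj]
      _ ≤ 64 * C / d ^ 2 * (8 * C / d) + (8 * C / d) * (64 * C / d ^ 2) :=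
          add_le_add (mul_le_mul (hfb' s) (hgb s) (norm_nonneg _) (by positivity))
            (mul_le_mul (hfb s) (hgb' s) (norm_nonneg _) (by positivity))
      _ = _ := by field_simp; ring
  set ψ : ℝ → ℝ := fun s => planarRadius D (s - t) - planarRadius D' (s - t') with hψ
  have hI : ∀ s, wave A D (s - t) * starRingEnd ℂ (wave A D' (s - t')) =
      Complex.exp (2 * Real.pi * Complex.I * (ψ s : ℂ)) * B s := fun s => by
    have : starRingEnd ℂ (Complex.exp (2 * Real.pi * Complex.I * (planarRadius D' (s - t') : ℂ))) =
        Complex.exp (-(2 * Real.pi * Complex.I * (planarRadius D' (s - t') : ℂ))) := by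
      rw [← Complex.exp_conj, map_mul, map_mul, map_mul, Complex.conj_ofReal, Complex.conj_ofReal,
        Complex.conj_I, map_ofNat]
      ring_nf
    simp only [wave, hB, hf, hg, map_mul, this, hψ]
    rw [Complex.ofReal_sub, mul_sub, sub_eq_add_neg (2 * (Real.pi : ℂ) * Complex.I * _),
      Complex.exp_add]
    ring
  simp_rw [hI]
  set x := |t - t'| with hx
  have hx0 : 0 ≤ x := abs_nonneg _
  -- The threshold `27648 = 8 * 3456` is where the longitudinal error `8 / d` drops below half of
  -- the transversal separation `x / (1728 * d)`.
  rcases le_total x 27648 with hsmall | hlarge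
  · have hEn : ∀ s, ‖Complex.exp (2 * Real.pi * Complex.I * (ψ s : ℂ)) * B s‖ ≤
        64 * C ^ 2 / d ^ 2 := fun s => by
      rw [norm_mul, show 2 * (Real.pi : ℂ) * Complex.I * (ψ s : ℂ) =
        ((2 * Real.pi * ψ s : ℝ) : ℂ) * Complex.I by push_cast; ring,
        Complex.norm_exp_ofReal_mul_I, one_mul]
      exact hBb s
    have := intervalIntegral.norm_integral_le_of_norm_le_const (a := α) (b := β)
      (f := fun s => Complex.exp (2 * Real.pi * Complex.I * (ψ s : ℂ)) * B s) fun s _ => hEn s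
    rw [abs_of_nonneg (sub_nonneg.2 hαβ)] at this
    calc _ ≤ 64 * C ^ 2 / d ^ 2 * (2 * d) := this.trans (by gcongr)
      _ = (128 * 27649) * C ^ 2 / (d * 27649) := by field_simp; ring
      _ ≤ (2 * N + 128 * 27649) * C ^ 2 / (d * (1 + x)) := by
          gcongr
          · linarith [show (0 : ℝ) ≤ N by positivity]
          · linarith
  · have hx1 : 0 < x := by linarith
    have hψ1 : ∀ s, HasDerivAt ψ (planarSin D (s - t) - planarSin D' (s - t')) s := fun s =>
      ((hasDerivAt_planarRadius_snd hD0 (s - t)).comp_sub_const s t).sub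
        ((hasDerivAt_planarRadius_snd hD0' (s - t')).comp_sub_const s t')
    have hψ2 : ∀ s, HasDerivAt (fun s => planarSin D (s - t) - planarSin D' (s - t'))
        (planarCos D (s - t) ^ 3 / D - planarCos D' (s - t') ^ 3 / D') s := fun s =>
      ((hasDerivAt_planarSin_snd hD0 (s - t)).comp_sub_const s t).sub
        ((hasDerivAt_planarSin_snd hD0' (s - t')).comp_sub_const s t')
    have hψ2c : Continuous fun s =>
        planarCos D (s - t) ^ 3 / D - planarCos D' (s - t') ^ 3 / D' := by
      have h1 := (contDiff_planarCos (n := 0) hD0).continuous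
      have h2 := (contDiff_planarCos (n := 0) hD0').continuous
      fun_prop
    have hss : ∀ s, |s - t - (s - t')| = x := fun s => by
      rw [hx, abs_sub_comm t t']; congr 1; ring
    -- Here `l` is the half of the separation that survives the longitudinal error, and `448 = 192 +
    -- 256` adds the two variations of the second derivative, using `|D - D'| ≤ 1 ≤ x`.
    have key := norm_integral_exp_mul_le (l := x / (3456 * d)) (κ := 448 * x / d ^ 2)
      (b₀ := 64 * C ^ 2 / d ^ 2) (b₁ := 1024 * C ^ 2 / d ^ 3) hαβ (by positivity) (by positivity)
      (by positivity) hψ1 hψ2 hψ2c hBc (fun s hs => ?_) (fun s hs => ?_) (fun s _ => hBb s)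
      (fun s _ => hBb' s)
    · have hq : 0 ≤ 1024 * C ^ 2 / d ^ 3 / (x / (3456 * d)) +
          64 * C ^ 2 / d ^ 2 * (448 * x / d ^ 2) / (x / (3456 * d)) ^ 2 := by positivity
      calc _ ≤ 2 * (64 * C ^ 2 / d ^ 2 / (x / (3456 * d))) +
            (1024 * C ^ 2 / d ^ 3 / (x / (3456 * d)) +
              64 * C ^ 2 / d ^ 2 * (448 * x / d ^ 2) / (x / (3456 * d)) ^ 2) * (2 * d) :=
            key.trans (by gcongr)
        _ = 2 * N * C ^ 2 / (d * (x + x)) := by rw [hN]; field_simp; ring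
        _ ≤ (2 * N + 128 * 27649) * C ^ 2 / (d * (1 + x)) := by
            gcongr
            · linarith
            · linarith
    · have e1 := abs_planarSin_sub_snd hd0 hD hD2 (ht s hs) (ht' s hs)
      have e2 := abs_planarSin_sub_fst hd0 hD hD' (s - t')
      rw [hss] at e1
      have e3 : 8 / d * |D - D'| ≤ 8 / d * 1 := by gcongr
      have e4 : 8 / d * 1 ≤ x / (3456 * d) := by
        rw [le_div_iff₀ (by positivity)]; field_simp; linarith
      have e5 : x / (1728 * d) = 2 * (x / (3456 * d)) := by field_simp; norm_num
      have e6 := abs_sub_abs_le_abs_sub (planarSin D (s - t) - planarSin D (s - t'))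
        (planarSin D' (s - t') - planarSin D (s - t'))
      rw [abs_sub_comm (planarSin D' (s - t'))] at e6
      rw [sub_sub_sub_cancel_right] at e6
      linarith
    · have e1 := abs_planarCos_pow_sub_snd hd0 hD (s - t) (s - t')
      have e2 := abs_planarCos_pow_sub_fst hd0 hD hD' (s - t')
      rw [hss] at e1
      have e3 : 256 / d ^ 2 * |D - D'| ≤ 256 / d ^ 2 * x := by gcongr; linarith
      have e4 : 448 * x / d ^ 2 = 192 / d ^ 2 * x + 256 / d ^ 2 * x := by ring
      rw [e4]
      exact (abs_sub_le _ (planarCos D (s - t') ^ 3 / D) _).trans (by linarith)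

/-! ### Schur's test, Sobolev inequality and large sieve -/

lemma Finset.sum_comp_le_mul_sum {ι κ : Type*} [DecidableEq κ] {s : Finset ι} {T : Finset κ}
    {f : ι → κ} (hf : ∀ j ∈ s, f j ∈ T) {m : ℕ} (hm : ∀ l ∈ T, (s.filter fun j => f j = l).card ≤ m)
    {φ : κ → ℝ} (hφ : ∀ l ∈ T, 0 ≤ φ l) : ∑ j ∈ s, φ (f j) ≤ m * ∑ l ∈ T, φ l := by
  rw [← Finset.sum_fiberwise_of_maps_to hf, Finset.mul_sum]
  refine Finset.sum_le_sum fun l hl => ?_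
  rw [Finset.sum_congr rfl (g := fun _ => φ l) fun j hj => by rw [(Finset.mem_filter.1 hj).2],
    Finset.sum_const, nsmul_eq_mul]
  exact mul_le_mul_of_nonneg_right (by exact_mod_cast hm l hl) (hφ l hl)

/-- A distance `k` is attained only at `l₀ - k` and `l₀ + k`, so the sum is at most twice a harmonic
sum. This is the source of the logarithm in the norm bound. -/
lemma sum_inv_one_add_abs_sub_le {n : ℕ} {l₀ : ℤ} (hl₀ : l₀ ∈ Finset.Ico (-n : ℤ) n) :
    ∑ l ∈ Finset.Ico (-n : ℤ) n, 1 / (1 + |(l₀ : ℝ) - l|) ≤ 2 * (1 + Real.log (2 * n)) := by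
  rw [Finset.mem_Ico] at hl₀
  have h1 : ∑ l ∈ Finset.Ico (-n : ℤ) n, 1 / (1 + |(l₀ : ℝ) - l|) =
      ∑ l ∈ Finset.Ico (-n : ℤ) n, (fun k : ℕ => 1 / (1 + (k : ℝ))) (l₀ - l).natAbs := by
    refine Finset.sum_congr rfl fun l _ => ?_
    simp only [Nat.cast_natAbs]
    push_cast
    rfl
  rw [h1]
  refine (Finset.sum_comp_le_mul_sum (T := Finset.range (2 * n)) (m := 2) (fun l hl => ?_)
    (fun k _ => ?_) fun k _ => one_div_nonneg.2 (show (0 : ℝ) ≤ 1 + k by positivity)).trans ?_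
  · rw [Finset.mem_Ico] at hl
    rw [Finset.mem_range]
    omega
  · calc _ ≤ ({l₀ - k, l₀ + k} : Finset ℤ).card := Finset.card_le_card fun l hl => by
          have := (Finset.mem_filter.1 hl).2
          rw [Finset.mem_insert, Finset.mem_singleton]
          omega
      _ ≤ 2 := Finset.card_le_two
  · have := harmonic_le_one_add_log (2 * n)
    rw [harmonic] at this
    push_cast at this ⊢
    refine mul_le_mul_of_nonneg_left (le_trans (le_of_eq ?_) this) two_pos.le
    refine Finset.sum_congr rfl fun k _ => ?_
    rw [one_div, add_comm]

/-- Schur's test for the Gram matrix of finitely many functions. -/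
lemma integral_norm_sum_mul_sq_le {ι : Type*} (s : Finset ι) {α β : ℝ} {g : ι → ℝ → ℂ}
    (hg : ∀ k ∈ s, Continuous (g k)) {W : ι → ι → ℝ} (hW : ∀ k k', W k k' = W k' k)
    (hgW : ∀ k ∈ s, ∀ k' ∈ s, ‖∫ x in α..β, g k x * starRingEnd ℂ (g k' x)‖ ≤ W k k') {b : ℝ}
    (hb : ∀ k ∈ s, ∑ k' ∈ s, W k k' ≤ b) (v : ι → ℂ) :
    ∫ x in α..β, ‖∑ k ∈ s, v k * g k x‖ ^ 2 ≤ b * ∑ k ∈ s, ‖v k‖ ^ 2 := by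
  have hgg : ∀ k ∈ s, ∀ k' ∈ s, Continuous fun x => g k x * starRingEnd ℂ (g k' x) :=
    fun k hk k' hk' => (hg k hk).mul (Complex.continuous_conj.comp (hg k' hk'))
  have hvgg : ∀ k ∈ s, ∀ k' ∈ s, Continuous fun x =>
      v k * starRingEnd ℂ (v k') * (g k x * starRingEnd ℂ (g k' x)) :=
    fun k hk k' hk' => continuous_const.mul (hgg k hk k' hk')
  have h1 : ((∫ x in α..β, ‖∑ k ∈ s, v k * g k x‖ ^ 2 : ℝ) : ℂ) =
      ∑ k ∈ s, ∑ k' ∈ s, v k * starRingEnd ℂ (v k') *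
        ∫ x in α..β, g k x * starRingEnd ℂ (g k' x) := by
    rw [← intervalIntegral.integral_ofReal]
    have : ∀ x, ((‖∑ k ∈ s, v k * g k x‖ ^ 2 : ℝ) : ℂ) = ∑ k ∈ s, ∑ k' ∈ s,
        v k * starRingEnd ℂ (v k') * (g k x * starRingEnd ℂ (g k' x)) := fun x => by
      rw [Complex.ofReal_pow, ← Complex.mul_conj', map_sum, Finset.sum_mul_sum]
      refine Finset.sum_congr rfl fun k _ => Finset.sum_congr rfl fun k' _ => ?_
      rw [map_mul]; ring
    simp_rw [this]
    rw [intervalIntegral.integral_finsetSum fun k hk => Continuous.intervalIntegrable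
      (continuous_finsetSum _ fun k' hk' => hvgg k hk k' hk') _ _]
    refine Finset.sum_congr rfl fun k hk => ?_
    rw [intervalIntegral.integral_finsetSum fun k' hk' => (hvgg k hk k' hk').intervalIntegrable _ _]
    refine Finset.sum_congr rfl fun k' hk' => ?_
    rw [intervalIntegral.integral_const_mul]
  have h2 : ∫ x in α..β, ‖∑ k ∈ s, v k * g k x‖ ^ 2 ≤
      ∑ k ∈ s, ∑ k' ∈ s, ‖v k‖ * ‖v k'‖ * W k k' := by
    refine (le_abs_self _).trans ?_
    rw [← Real.norm_eq_abs, ← Complex.norm_real, h1]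
    refine norm_sum_le_of_le _ fun k hk => norm_sum_le_of_le _ fun k' hk' => ?_
    rw [norm_mul, norm_mul, RCLike.norm_conj]
    gcongr
    exact hgW k hk k' hk'
  have hW0 : ∀ k ∈ s, ∀ k' ∈ s, 0 ≤ W k k' := fun k hk k' hk' =>
    (norm_nonneg _).trans (hgW k hk k' hk')
  -- The inequality between geometric and arithmetic means, followed by the symmetry of `W`, reduces
  -- the double sum to row sums.
  have h3 : ∑ k ∈ s, ∑ k' ∈ s, ‖v k‖ * ‖v k'‖ * W k k' ≤
      ∑ k ∈ s, ∑ k' ∈ s, (‖v k‖ ^ 2 * W k k' + ‖v k'‖ ^ 2 * W k' k) / 2 := by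
    refine Finset.sum_le_sum fun k hk => Finset.sum_le_sum fun k' hk' => ?_
    rw [hW k' k]
    nlinarith [mul_nonneg (sq_nonneg (‖v k‖ - ‖v k'‖)) (hW0 k hk k' hk')]
  have h4 : ∑ k ∈ s, ∑ k' ∈ s, ‖v k‖ ^ 2 * W k k' ≤ b * ∑ k ∈ s, ‖v k‖ ^ 2 := by
    rw [Finset.mul_sum]
    refine Finset.sum_le_sum fun k hk => ?_
    rw [← Finset.mul_sum, mul_comm b]
    exact mul_le_mul_of_nonneg_left (hb k hk) (sq_nonneg _)
  have h5 : ∑ k ∈ s, ∑ k' ∈ s, (‖v k‖ ^ 2 * W k k' + ‖v k'‖ ^ 2 * W k' k) / 2 =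
      ∑ k ∈ s, ∑ k' ∈ s, ‖v k‖ ^ 2 * W k k' := by
    simp_rw [add_div, Finset.sum_add_distrib]
    rw [Finset.sum_comm (f := fun k k' => ‖v k'‖ ^ 2 * W k' k / 2)]
    simp_rw [← Finset.sum_add_distrib, add_halves]
  linarith

/-- The one-dimensional Sobolev inequality on an interval of length `1`. -/
lemma norm_sq_le_integral {x u : ℝ} (hu : u ∈ Set.Icc x (x + 1)) {g g' : ℝ → ℂ}
    (hg : ∀ w ∈ Set.Icc x (x + 1), HasDerivAt g (g' w) w)
    (hg' : ContinuousOn g' (Set.Icc x (x + 1))) :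
    ‖g u‖ ^ 2 ≤ 2 * ∫ w in x..x + 1, (‖g w‖ ^ 2 + ‖g' w‖ ^ 2) := by
  have hx : x ≤ x + 1 := by linarith
  have hgc : ContinuousOn g (Set.Icc x (x + 1)) := fun w hw => (hg w hw).continuousAt.continuousWithinAt
  have i1 : IntervalIntegrable (fun w => ‖g w‖ ^ 2) volume x (x + 1) :=
    (hgc.norm.pow 2).intervalIntegrable_of_Icc hx
  have i2 : IntervalIntegrable (fun w => ‖g' w‖ ^ 2) volume x (x + 1) :=
    (hg'.norm.pow 2).intervalIntegrable_of_Icc hx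
  have i3 : IntervalIntegrable (fun w => ‖g' w‖) volume x (x + 1) :=
    hg'.norm.intervalIntegrable_of_Icc hx
  set I := ∫ w in x..x + 1, ‖g' w‖ with hI
  -- Cauchy–Schwarz on a unit interval, read off from the nonnegative variance of `‖g'‖`.
  have cs : I ^ 2 ≤ ∫ w in x..x + 1, ‖g' w‖ ^ 2 := by
    have h0 : 0 ≤ ∫ w in x..x + 1, (‖g' w‖ - I) ^ 2 :=
      intervalIntegral.integral_nonneg hx fun w _ => sq_nonneg _
    have h1 : ∫ w in x..x + 1, (‖g' w‖ - I) ^ 2 = (∫ w in x..x + 1, ‖g' w‖ ^ 2) - I ^ 2 := by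
      have : ∀ w, (‖g' w‖ - I) ^ 2 = ‖g' w‖ ^ 2 - 2 * I * ‖g' w‖ + I ^ 2 := fun w => by ring
      simp_rw [this]
      rw [intervalIntegral.integral_add (i2.sub (i3.const_mul _)) intervalIntegrable_const,
        intervalIntegral.integral_sub i2 (i3.const_mul _), intervalIntegral.integral_const_mul,
        intervalIntegral.integral_const, ← hI]
      simp only [add_sub_cancel_left, one_smul]
      ring
    linarith
  -- The value at `u` differs from that at any `w` by at most `I`; averaging over `w` then gives the
  -- claim.
  have key : ∀ w ∈ Set.Icc x (x + 1), ‖g u‖ ^ 2 ≤ 2 * (‖g w‖ ^ 2 + I ^ 2) := fun w hw => by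
    have hsub : Set.uIcc w u ⊆ Set.Icc x (x + 1) := Set.uIcc_subset_Icc hw hu
    have h1 : ∫ y in w..u, g' y = g u - g w :=
      intervalIntegral.integral_eq_sub_of_hasDerivAt (fun y hy => hg y (hsub hy))
        (hg'.mono hsub).intervalIntegrable
    have h2 : ‖∫ y in w..u, g' y‖ ≤ I := by
      refine intervalIntegral.norm_integral_le_abs_integral_norm.trans ?_
      rw [← abs_of_nonneg (show 0 ≤ I from intervalIntegral.integral_nonneg hx fun _ _ => norm_nonneg _)]
      refine intervalIntegral.abs_integral_mono_interval ?_
        (Filter.Eventually.of_forall fun _ => norm_nonneg _) i3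
      rw [Set.uIoc_of_le hx]
      exact Set.Ioc_subset_Ioc (le_min hw.1 hu.1) (max_le hw.2 hu.2)
    have h3 : ‖g u‖ ≤ ‖g w‖ + I := by
      have : g u = g w + ∫ y in w..u, g' y := by rw [h1]; ring
      rw [this]
      exact (norm_add_le _ _).trans (by gcongr)
    calc ‖g u‖ ^ 2 ≤ (‖g w‖ + I) ^ 2 := by gcongr
      _ ≤ _ := by nlinarith [sq_nonneg (‖g w‖ - I)]
  have hmono : ∫ _ in x..x + 1, ‖g u‖ ^ 2 ≤ ∫ w in x..x + 1, 2 * (‖g w‖ ^ 2 + I ^ 2) :=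
    intervalIntegral.integral_mono_on hx intervalIntegrable_const
      ((i1.add intervalIntegrable_const).const_mul 2) key
  rw [intervalIntegral.integral_const_mul, intervalIntegral.integral_add i1 intervalIntegrable_const,
    intervalIntegral.integral_const, intervalIntegral.integral_const] at hmono
  simp only [add_sub_cancel_left, one_smul] at hmono
  rw [intervalIntegral.integral_add i1 i2]
  linarith

/-- A large sieve inequality: values at points of which at most `m` lie in each unit interval. -/
lemma sum_norm_sq_le_integral {ι : Type*} {s : Finset ι} {x : ι → ℝ} {n m : ℕ}
    (hx : ∀ j ∈ s, ⌊x j⌋ ∈ Finset.Ico (-n : ℤ) n)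
    (hm : ∀ l : ℤ, (s.filter fun j => ⌊x j⌋ = l).card ≤ m) {g g' : ℝ → ℂ}
    (hg : ∀ w, HasDerivAt g (g' w) w) (hg' : Continuous g') :
    ∑ j ∈ s, ‖g (x j)‖ ^ 2 ≤ m * (2 * ∫ w in (-n : ℝ)..n, (‖g w‖ ^ 2 + ‖g' w‖ ^ 2)) := by
  have hgc : Continuous g := continuous_iff_continuousAt.2 fun w => (hg w).continuousAt
  have hc : Continuous fun w => ‖g w‖ ^ 2 + ‖g' w‖ ^ 2 := by fun_prop
  -- Shifting integer parts by `n` numbers the unit intervals by naturals, so that their integrals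
  -- add up to the one over the whole segment.
  set φ : ℕ → ℝ := fun k => 2 * ∫ w in (-n + k : ℝ)..(-n + (k + 1 : ℕ)), (‖g w‖ ^ 2 + ‖g' w‖ ^ 2)
    with hφ
  have h1 : ∀ j ∈ s, ‖g (x j)‖ ^ 2 ≤ φ (⌊x j⌋ + n).toNat := fun j hj => by
    have h := Finset.mem_Ico.1 (hx j hj)
    have hk : (((⌊x j⌋ + n).toNat : ℕ) : ℝ) = ⌊x j⌋ + n := by
      have : (((⌊x j⌋ + n).toNat : ℕ) : ℤ) = ⌊x j⌋ + n := Int.toNat_of_nonneg (by omega)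
      exact_mod_cast this
    have := norm_sq_le_integral (x := ⌊x j⌋) (u := x j)
      ⟨Int.floor_le _, (Int.lt_floor_add_one _).le⟩ (fun w _ => hg w) hg'.continuousOn
    simp only [hφ]
    push_cast
    rw [hk]
    convert this using 3 <;> ring
  refine (Finset.sum_le_sum h1).trans ((Finset.sum_comp_le_mul_sum (T := Finset.range (2 * n))
    (m := m) (fun j hj => ?_) (fun k _ => ?_) (fun k _ => ?_)).trans (le_of_eq ?_))
  · have h := Finset.mem_Ico.1 (hx j hj)
    rw [Finset.mem_range]
    omega
  · refine le_trans (Finset.card_le_card fun j hj => ?_) (hm (k - n))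
    have h := Finset.mem_filter.1 hj
    have h' := Finset.mem_Ico.1 (hx j h.1)
    exact Finset.mem_filter.2 ⟨h.1, by omega⟩
  · refine mul_nonneg two_pos.le (intervalIntegral.integral_nonneg ?_ fun w _ => by positivity)
    push_cast; linarith
  · congr 1
    rw [hφ, ← Finset.mul_sum, intervalIntegral.sum_integral_adjacent_intervals
      (a := fun k : ℕ => (-n + k : ℝ)) fun k _ => hc.intervalIntegrable _ _]
    push_cast
    ring_nf

/-! ### Energy on segments, strips and whole clusters -/

lemma continuousOn_wave_losAmpFst_fst (u : ℝ) :
    ContinuousOn (fun D => wave losAmpFst D u) (Set.Ioi 0) := by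
  have h1 : ContinuousOn (fun D => (planarRadius D u : ℂ)) (Set.Ioi 0) := fun D hD =>
    (hasDerivAt_planarRadius_fst hD u).ofReal_comp.continuousAt.continuousWithinAt
  have h2 : ContinuousOn (fun D => (planarCos D u : ℂ)) (Set.Ioi 0) := fun D hD =>
    (hasDerivAt_planarCos_fst hD u).ofReal_comp.continuousAt.continuousWithinAt
  have h3 : ContinuousOn (fun D : ℝ => (D : ℂ)) (Set.Ioi 0) :=
    Complex.continuous_ofReal.continuousOn
  have h4 : ∀ D ∈ Set.Ioi (0 : ℝ), (D : ℂ) ≠ 0 := fun D hD => by exact_mod_cast (ne_of_gt hD)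
  unfold wave losAmpFst
  exact (continuousOn_const.mul h1).cexp.mul (((h2.mul h2).mul (continuousOn_const.add
    (continuousOn_const.mul (h2.mul (h3.inv₀ h4))))).div h3 h4)

/-- The energy received on a segment from sources in a common slab. -/
lemma IsSymbol.exists_integral_wave_le {A : ℝ → ℝ → ℂ} (hA : IsSymbol A) :
    ∃ K : ℝ, 0 ≤ K ∧ ∀ (κ : Type) (q : Finset κ) (D t : κ → ℝ) (v : κ → ℂ) (d : ℝ) (n m : ℕ),
      8 ≤ d → 1 ≤ n → n ≤ d → (∀ k ∈ q, d / 8 ≤ D k ∧ D k ≤ 2 * d) →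
      (∀ k ∈ q, ∀ k' ∈ q, |D k - D k'| ≤ 1) → (∀ k ∈ q, ⌊t k⌋ ∈ Finset.Ico (-n : ℤ) n) →
      (∀ l : ℤ, (q.filter fun k => ⌊t k⌋ = l).card ≤ m) →
      ∫ w in (-n : ℝ)..n, ‖∑ k ∈ q, v k * wave A (D k) (w - t k)‖ ^ 2 ≤
        K * (m * (1 + Real.log (2 * n)) / d) * ∑ k ∈ q, ‖v k‖ ^ 2 := by
  obtain ⟨K, hK, h⟩ := hA.exists_wave_correlation_le
  -- One factor `2` pays for rounding positions to integer parts, the other for the two-sided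
  -- harmonic sum.
  refine ⟨4 * K, by positivity, fun κ q D t v d n m hd hn hnd hD hDD ht hm => ?_⟩
  have hd0 : 0 < d := by linarith
  have htn : ∀ k ∈ q, t k ∈ Set.Icc (-n : ℝ) n := fun k hk => by
    have h' := Finset.mem_Ico.1 (ht k hk)
    have h1 : ((-n : ℤ) : ℝ) ≤ ⌊t k⌋ := by exact_mod_cast h'.1
    have h2 : ((⌊t k⌋ + 1 : ℤ) : ℝ) ≤ (n : ℤ) := by exact_mod_cast h'.2
    push_cast at h1 h2
    exact ⟨h1.trans (Int.floor_le _), (Int.lt_floor_add_one _).le.trans h2⟩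
  have hsub : ∀ k ∈ q, ∀ s ∈ Set.Icc (-n : ℝ) n, |s - t k| ≤ 2 * d := fun k hk s hs => by
    have := htn k hk
    rw [abs_le]
    constructor <;> linarith [hs.1, hs.2, this.1, this.2]
  refine integral_norm_sum_mul_sq_le q (W := fun k k' => K / (d * (1 + |t k - t k'|)))
    (fun k hk => ((contDiff_wave (by linarith [hD k hk]) hA).continuous.comp
      (continuous_id.sub continuous_const))) (fun k k' => by rw [abs_sub_comm])
    (fun k hk k' hk' => h d (D k) (D k') (t k) (t k') _ _ hd (hD k hk).1 (hD k hk).2 (hD k' hk').1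
      (hD k' hk').2 (hDD k hk k' hk') (by linarith) (by linarith) (hsub k hk) (hsub k' hk'))
    (fun k hk => ?_) v
  have h1 : ∀ k' ∈ q, K / (d * (1 + |t k - t k'|)) ≤
      2 * K / d * (1 / (1 + |(⌊t k⌋ : ℝ) - ⌊t k'⌋|)) := fun k' _ => by
    have : 1 + |(⌊t k⌋ : ℝ) - ⌊t k'⌋| ≤ 2 * (1 + |t k - t k'|) := by
      have : |(⌊t k⌋ : ℝ) - ⌊t k'⌋| ≤ |t k - t k'| + 1 := by
        have e1 := Int.floor_le (t k)
        have e2 := Int.lt_floor_add_one (t k)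
        have e3 := Int.floor_le (t k')
        have e4 := Int.lt_floor_add_one (t k')
        rw [abs_le]
        constructor <;> linarith [le_abs_self (t k - t k'), neg_abs_le (t k - t k')]
      linarith [abs_nonneg (t k - t k')]
    calc K / (d * (1 + |t k - t k'|)) = 2 * K / d * (1 / (2 * (1 + |t k - t k'|))) := by
          field_simp
      _ ≤ _ := by gcongr
  have h2 := Finset.sum_comp_le_mul_sum (s := q) (f := fun k' => ⌊t k'⌋) ht (fun l _ => hm l)
    (φ := fun l => 1 / (1 + |(⌊t k⌋ : ℝ) - l|)) fun l _ => by positivity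
  calc _ ≤ ∑ k' ∈ q, 2 * K / d * (1 / (1 + |(⌊t k⌋ : ℝ) - ⌊t k'⌋|)) := Finset.sum_le_sum h1
    _ = 2 * K / d * ∑ k' ∈ q, 1 / (1 + |(⌊t k⌋ : ℝ) - ⌊t k'⌋|) := by rw [Finset.mul_sum]
    _ ≤ 2 * K / d * (m * (2 * (1 + Real.log (2 * n)))) := by
        gcongr
        exact h2.trans (by gcongr; exact sum_inv_one_add_abs_sub_le (ht k hk))
    _ = _ := by ring

/-- The energy received in a unit strip from sources in a unit slab. -/
lemma exists_sum_strip_wave_le :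
    ∃ K : ℝ, 0 ≤ K ∧ ∀ (ι κ : Type) (s : Finset ι) (q : Finset κ) (a x : ι → ℝ) (b t : κ → ℝ)
      (v : κ → ℂ) (d : ℝ) (n m : ℕ) (i β : ℤ), 8 ≤ d → 1 ≤ n → n ≤ d → (∀ j ∈ s, ⌊a j⌋ = i) →
      (∀ k ∈ q, ⌊b k⌋ = β) → (∀ j ∈ s, ⌊x j⌋ ∈ Finset.Ico (-n : ℤ) n) →
      (∀ k ∈ q, ⌊t k⌋ ∈ Finset.Ico (-n : ℤ) n) →
      (∀ l : ℤ, (s.filter fun j => ⌊x j⌋ = l).card ≤ m) →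
      (∀ l : ℤ, (q.filter fun k => ⌊t k⌋ = l).card ≤ m) →
      (∀ y ∈ Set.Icc (i : ℝ) (i + 1), ∀ k ∈ q, d / 8 ≤ d + y - b k ∧ d + y - b k ≤ 2 * d) →
      ∑ j ∈ s, ‖∑ k ∈ q, v k * wave losAmp (d + a j - b k) (x j - t k)‖ ^ 2 ≤
        K * (m ^ 2 * (1 + Real.log (2 * n)) / d) * ∑ k ∈ q, ‖v k‖ ^ 2 := by
  obtain ⟨K₁, hK₁, h₁⟩ := isSymbol_losAmp.exists_integral_wave_le
  obtain ⟨K₂, hK₂, h₂⟩ := isSymbol_losAmpSnd.exists_integral_wave_le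
  obtain ⟨K₃, hK₃, h₃⟩ := isSymbol_losAmpFst.exists_integral_wave_le
  obtain ⟨K₄, hK₄, h₄⟩ := isSymbol_losAmpMixed.exists_integral_wave_le
  -- The factor `4` comes from the two Sobolev inequalities, transversal and longitudinal. They
  -- involve the kernel, its two first derivatives and the mixed one, hence four constants.
  refine ⟨4 * (K₁ + K₂ + K₃ + K₄), by positivity, ?_⟩
  intro ι κ s q a x b t v d n m i β hd hn hnd ha hb hx ht hmx hmt hD
  have hd0 : 0 < d := by linarith
  set T := ∑ k ∈ q, ‖v k‖ ^ 2 with hT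
  set Λ := m * (1 + Real.log (2 * n)) / d with hΛ
  set f : (ℝ → ℝ → ℂ) → ℝ → ℝ → ℂ := fun A y w => ∑ k ∈ q, v k * wave A (d + y - b k) (w - t k)
    with hf
  have hbb : ∀ y, ∀ k ∈ q, ∀ k' ∈ q, |d + y - b k - (d + y - b k')| ≤ 1 := fun y k hk k' hk' => by
    have h := Int.abs_sub_lt_one_of_floor_eq_floor ((hb k' hk').trans (hb k hk).symm)
    rw [show d + y - b k - (d + y - b k') = b k' - b k by ring]
    exact h.le
  have hcont : ∀ {A : ℝ → ℝ → ℂ}, IsSymbol A → ∀ y ∈ Set.Icc (i : ℝ) (i + 1),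
      Continuous (f A y) := fun hA y hy => continuous_finsetSum _ fun k hk =>
    continuous_const.mul ((contDiff_wave (by linarith [hD y hy k hk]) hA).continuous.comp
      (continuous_id.sub continuous_const))
  have transversal : ∀ {A A' : ℝ → ℝ → ℂ}, IsSymbol A → IsSymbol A' →
      (∀ D, 0 < D → ∀ u, HasDerivAt (wave A D) (wave A' D u) u) →
      ∀ y ∈ Set.Icc (i : ℝ) (i + 1), ∑ j ∈ s, ‖f A y (x j)‖ ^ 2 ≤
        m * (2 * ((∫ w in (-n : ℝ)..n, ‖f A y w‖ ^ 2) + ∫ w in (-n : ℝ)..n, ‖f A' y w‖ ^ 2)) := by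
    intro A A' hA hA' hder y hy
    have hsq : ∀ {A : ℝ → ℝ → ℂ}, IsSymbol A →
        IntervalIntegrable (fun w => ‖f A y w‖ ^ 2) volume (-n : ℝ) n := fun hA =>
      ((hcont hA y hy).norm.pow 2).intervalIntegrable _ _
    rw [← intervalIntegral.integral_add (hsq hA) (hsq hA')]
    refine sum_norm_sq_le_integral hx hmx (fun w => ?_) (hcont hA' y hy)
    refine HasDerivAt.fun_sum fun k hk => ?_
    exact ((hder _ (by linarith [hD y hy k hk]) (w - t k)).comp_sub_const w (t k)).const_mul (v k)
  have hbound : ∀ y ∈ Set.Icc (i : ℝ) (i + 1),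
      ∑ j ∈ s, (‖f losAmp y (x j)‖ ^ 2 + ‖f losAmpFst y (x j)‖ ^ 2) ≤
        2 * m * (K₁ + K₂ + K₃ + K₄) * Λ * T := fun y hy => by
    rw [Finset.sum_add_distrib]
    have e1 := transversal isSymbol_losAmp isSymbol_losAmpSnd
      (fun D hD u => hasDerivAt_wave_losAmp_snd hD u) y hy
    have e2 := transversal isSymbol_losAmpFst isSymbol_losAmpMixed
      (fun D hD u => hasDerivAt_wave_losAmpFst_snd hD u) y hy
    have g1 := h₁ κ q (fun k => d + y - b k) t v d n m hd hn hnd (hD y hy) (hbb y) ht hmt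
    have g2 := h₂ κ q (fun k => d + y - b k) t v d n m hd hn hnd (hD y hy) (hbb y) ht hmt
    have g3 := h₃ κ q (fun k => d + y - b k) t v d n m hd hn hnd (hD y hy) (hbb y) ht hmt
    have g4 := h₄ κ q (fun k => d + y - b k) t v d n m hd hn hnd (hD y hy) (hbb y) ht hmt
    calc _ ≤ _ := add_le_add e1 e2
      _ ≤ m * (2 * (K₁ * Λ * T + K₂ * Λ * T)) + m * (2 * (K₃ * Λ * T + K₄ * Λ * T)) := by gcongr
      _ = _ := by ring
  have hii : (i : ℝ) ≤ i + 1 := by linarith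
  have hpos : ∀ y ∈ Set.Icc (i : ℝ) (i + 1), ∀ k ∈ q, 0 < d + y - b k := fun y hy k hk => by
    linarith [hD y hy k hk]
  have hder : ∀ w, ∀ y ∈ Set.Icc (i : ℝ) (i + 1),
      HasDerivAt (fun y => f losAmp y w) (f losAmpFst y w) y := fun w y hy => by
    refine HasDerivAt.fun_sum fun k hk => HasDerivAt.const_mul _ ?_
    have hg : HasDerivAt (fun y => d + y - b k) 1 y := ((hasDerivAt_id y).const_add d).sub_const _
    have := (hasDerivAt_wave_losAmp_fst (hpos y hy k hk) (w - t k)).scomp y hg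
    rwa [one_smul] at this
  have hcFst : ∀ w, ContinuousOn (fun y => f losAmpFst y w) (Set.Icc (i : ℝ) (i + 1)) := fun w =>
    continuousOn_finsetSum _ fun k hk => continuousOn_const.mul
      ((continuousOn_wave_losAmpFst_fst (w - t k)).comp (by fun_prop) fun y hy => hpos y hy k hk)
  have hcLos : ∀ w, ContinuousOn (fun y => f losAmp y w) (Set.Icc (i : ℝ) (i + 1)) :=
    fun w y hy => (hder w y hy).continuousAt.continuousWithinAt
  have hci : ∀ j ∈ s, IntervalIntegrable
      (fun y => ‖f losAmp y (x j)‖ ^ 2 + ‖f losAmpFst y (x j)‖ ^ 2) volume i (i + 1) := fun j _ =>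
    (((hcLos (x j)).norm.pow 2).add ((hcFst (x j)).norm.pow 2)).intervalIntegrable_of_Icc hii
  -- The longitudinal Sobolev inequality replaces the individual `a j` by an average over the strip,
  -- putting all receivers on a common segment for each `y`.
  have hj : ∀ j ∈ s, ‖f losAmp (a j) (x j)‖ ^ 2 ≤
      2 * ∫ y in (i : ℝ)..i + 1, (‖f losAmp y (x j)‖ ^ 2 + ‖f losAmpFst y (x j)‖ ^ 2) := fun j hj =>
    norm_sq_le_integral (g := fun y => f losAmp y (x j)) (by
      rw [← ha j hj]; exact ⟨Int.floor_le _, (Int.lt_floor_add_one _).le⟩) (hder (x j)) (hcFst (x j))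
  have hmono := intervalIntegral.integral_mono_on hii (IntervalIntegrable.sum s hci)
    (intervalIntegrable_const (c := 2 * m * (K₁ + K₂ + K₃ + K₄) * Λ * T)) fun y hy => by
      rw [Finset.sum_apply]; exact hbound y hy
  rw [intervalIntegral.integral_const, add_sub_cancel_left, one_smul] at hmono
  simp only [Finset.sum_apply] at hmono
  rw [intervalIntegral.integral_finsetSum hci] at hmono
  calc _ ≤ _ := Finset.sum_le_sum hj
    _ ≤ 2 * (2 * m * (K₁ + K₂ + K₃ + K₄) * Λ * T) := by rw [← Finset.mul_sum]; gcongr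
    _ = _ := by rw [hΛ]; ring

lemma norm_sum_sq_le_card_mul {ι : Type*} (s : Finset ι) (z : ι → ℂ) :
    ‖∑ i ∈ s, z i‖ ^ 2 ≤ s.card * ∑ i ∈ s, ‖z i‖ ^ 2 :=
  (pow_le_pow_left₀ (norm_nonneg _) (norm_sum_le _ _) 2).trans sq_sum_le_card_mul_sum_sq

/-- The energy received from sources such that each unit cell contains at most `m` of them, by
receivers with the same property. -/
lemma exists_sum_wave_le :
    ∃ K : ℝ, 0 ≤ K ∧ ∀ (ι κ : Type) (s : Finset ι) (q : Finset κ) (a x : ι → ℝ) (b t : κ → ℝ)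
      (v : κ → ℂ) (d r : ℝ) (n m : ℕ), 8 ≤ d → n ≤ d → r < n → 2 * r + 1 ≤ 7 / 8 * d →
      (∀ j ∈ s, |a j| ≤ r ∧ |x j| ≤ r) → (∀ k ∈ q, |b k| ≤ r ∧ |t k| ≤ r) →
      (∀ i l : ℤ, (s.filter fun j => ⌊a j⌋ = i ∧ ⌊x j⌋ = l).card ≤ m) →
      (∀ i l : ℤ, (q.filter fun k => ⌊b k⌋ = i ∧ ⌊t k⌋ = l).card ≤ m) →
      ∑ j ∈ s, ‖∑ k ∈ q, v k * wave losAmp (d + a j - b k) (x j - t k)‖ ^ 2 ≤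
        K * (n ^ 2 * m ^ 2 * (1 + Real.log (2 * n)) / d) * ∑ k ∈ q, ‖v k‖ ^ 2 := by
  obtain ⟨K, hK, h⟩ := exists_sum_strip_wave_le
  refine ⟨4 * K, by positivity, ?_⟩
  intro ι κ s q a x b t v d r n m hd hnd hrn hrd hs hq hms hmq
  rcases s.eq_empty_or_nonempty with rfl | ⟨j₀, hj₀⟩
  · rw [Finset.sum_empty]
    have : 0 ≤ Real.log (2 * n) := by exact_mod_cast Real.log_natCast_nonneg (2 * n)
    have : 0 ≤ d := by linarith
    positivity
  have hr : 0 ≤ r := (abs_nonneg _).trans (hs j₀ hj₀).1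
  have hn : 1 ≤ n := by
    have : (0 : ℝ) < n := by linarith
    exact_mod_cast this
  have hfl : ∀ y : ℝ, |y| ≤ r → ⌊y⌋ ∈ Finset.Ico (-n : ℤ) n := fun y hy => by
    have := abs_le.1 hy
    rw [Finset.mem_Ico, Int.le_floor, Int.floor_lt]
    push_cast
    constructor <;> linarith
  set I := Finset.Ico (-n : ℤ) n with hI
  have hIc : (I.card : ℝ) = 2 * n := by
    have : I.card = 2 * n := by rw [hI, Int.card_Ico]; omega
    rw [this]; push_cast; ring
  set B := K * (m ^ 2 * (1 + Real.log (2 * n)) / d) with hB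
  set Q : ℤ → Finset κ := fun β => q.filter fun k => ⌊b k⌋ = β with hQ
  set S : ℤ → Finset ι := fun i => s.filter fun j => ⌊a j⌋ = i with hS
  set F : ℤ → ι → ℂ := fun β j => ∑ k ∈ Q β, v k * wave losAmp (d + a j - b k) (x j - t k) with hF
  have hblock : ∀ β ∈ I, ∀ i ∈ I, ∑ j ∈ S i, ‖F β j‖ ^ 2 ≤ B * ∑ k ∈ Q β, ‖v k‖ ^ 2 := by
    intro β _ i _
    -- An actual receiver in the strip is needed to confine `y`: then `|y - b k| ≤ 2 * r + 1 ≤ 7 / 8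
    -- * d`, which keeps the longitudinal distance between `d / 8` and `2 * d`.
    rcases (S i).eq_empty_or_nonempty with hSi | ⟨j₁, hj₁⟩
    · rw [hSi, Finset.sum_empty]
      have : 0 ≤ Real.log (2 * n) := by exact_mod_cast Real.log_natCast_nonneg (2 * n)
      have : 0 ≤ d := by linarith
      positivity
    refine h ι κ (S i) (Q β) a x b t v d n m i β hd hn hnd (fun j hj => (Finset.mem_filter.1 hj).2)
      (fun k hk => (Finset.mem_filter.1 hk).2)
      (fun j hj => hfl _ (hs j (Finset.mem_filter.1 hj).1).2)
      (fun k hk => hfl _ (hq k (Finset.mem_filter.1 hk).1).2) (fun l => ?_) (fun l => ?_)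
      fun y hy k hk => ?_
    · rw [hS, Finset.filter_filter]; exact hms i l
    · rw [hQ, Finset.filter_filter]; exact hmq β l
    · have hj := Finset.mem_filter.1 hj₁
      have e1 := abs_le.1 (hs j₁ hj.1).1
      have e2 := abs_le.1 (hq k (Finset.mem_filter.1 hk).1).1
      have e3 := Int.floor_le (a j₁)
      have e4 := Int.lt_floor_add_one (a j₁)
      rw [hj.2] at e3 e4
      constructor <;> linarith [hy.1, hy.2]
  have hsplit : ∀ j, ∑ k ∈ q, v k * wave losAmp (d + a j - b k) (x j - t k) = ∑ β ∈ I, F β j :=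
    fun j => (Finset.sum_fiberwise_of_maps_to (fun k hk => hfl _ (hq k hk).1) _).symm
  -- Cauchy–Schwarz over the `2 * n` slabs costs one factor `2 * n` and the number of strips
  -- another. The slabs partition the sources, so their energies add up without loss.
  calc ∑ j ∈ s, ‖∑ k ∈ q, v k * wave losAmp (d + a j - b k) (x j - t k)‖ ^ 2
      ≤ ∑ j ∈ s, 2 * n * ∑ β ∈ I, ‖F β j‖ ^ 2 := by
        refine Finset.sum_le_sum fun j _ => ?_
        rw [hsplit, ← hIc]
        exact norm_sum_sq_le_card_mul _ _
    _ = 2 * n * ∑ β ∈ I, ∑ i ∈ I, ∑ j ∈ S i, ‖F β j‖ ^ 2 := by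
        rw [← Finset.mul_sum, Finset.sum_comm]
        congr 1
        refine Finset.sum_congr rfl fun β _ => ?_
        exact (Finset.sum_fiberwise_of_maps_to (fun j hj => hfl _ (hs j hj).1) _).symm
    _ ≤ 2 * n * ∑ β ∈ I, ∑ i ∈ I, B * ∑ k ∈ Q β, ‖v k‖ ^ 2 := by
        gcongr with β hβ i hi
        exact hblock β hβ i hi
    _ = 4 * K * (n ^ 2 * m ^ 2 * (1 + Real.log (2 * n)) / d) * ∑ k ∈ q, ‖v k‖ ^ 2 := by
        simp_rw [Finset.sum_const, nsmul_eq_mul, hIc]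
        rw [← Finset.mul_sum, ← Finset.mul_sum,
          Finset.sum_fiberwise_of_maps_to (fun k hk => hfl _ (hq k hk).1), hB]
        ring

/-! ### Rotated frames, squares and unit grids -/

/-- The rotation of the plane that sends `(cos θ, sin θ)` to the first basis vector. -/
noncomputable def planeRotation (θ : ℝ) : Plane ≃ₗᵢ[ℝ] Plane :=
  LinearIsometry.toLinearIsometryEquiv
    { toFun := fun x => !₂[Real.cos θ * x 0 + Real.sin θ * x 1, -Real.sin θ * x 0 + Real.cos θ * x 1]
      map_add' := fun x y => by ext i; fin_cases i <;> simp <;> ring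
      map_smul' := fun c x => by ext i; fin_cases i <;> simp <;> ring
      norm_map' := fun x => by
        rw [← sq_eq_sq₀ (norm_nonneg _) (norm_nonneg _), EuclideanSpace.real_norm_sq_eq,
          EuclideanSpace.real_norm_sq_eq, Fin.sum_univ_two, Fin.sum_univ_two]
        simp
        linear_combination (x 0 ^ 2 + x 1 ^ 2) * Real.sin_sq_add_cos_sq θ } rfl

/-- Coordinates in the orthonormal frame at `o` whose first axis is `(cos θ, sin θ)`. -/
noncomputable def planeFrame (o : Plane) (θ : ℝ) (x : Plane) : Plane := planeRotation θ (x - o)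

lemma planeRotation_zero (θ : ℝ) (x : Plane) :
    planeRotation θ x 0 = Real.cos θ * x 0 + Real.sin θ * x 1 := rfl

lemma planeRotation_one (θ : ℝ) (x : Plane) :
    planeRotation θ x 1 = -Real.sin θ * x 0 + Real.cos θ * x 1 := rfl

lemma measurePreserving_planeFrame (o : Plane) (θ : ℝ) :
    MeasurePreserving (planeFrame o θ) volume volume :=
  (planeRotation θ).measurePreserving.comp (measurePreserving_sub_right volume o)

lemma measurableSet_planeFrame (o : Plane) (θ : ℝ) {A B : Set ℝ} (hA : MeasurableSet A)
    (hB : MeasurableSet B) : MeasurableSet {x | planeFrame o θ x 0 ∈ A ∧ planeFrame o θ x 1 ∈ B} := by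
  have h : ∀ i : Fin 2, Measurable fun x => planeFrame o θ x i := fun i =>
    (measurable_pi_apply i).comp ((PiLp.volume_preserving_ofLp (Fin 2)).measurable.comp
      (measurePreserving_planeFrame o θ).measurable)
  exact (h 0 hA).inter (h 1 hB)

lemma volume_planeFrame (o : Plane) (θ : ℝ) {A B : Set ℝ} (hA : MeasurableSet A)
    (hB : MeasurableSet B) :
    volume {x | planeFrame o θ x 0 ∈ A ∧ planeFrame o θ x 1 ∈ B} = volume A * volume B := by
  have h := (PiLp.volume_preserving_ofLp (Fin 2)).comp (measurePreserving_planeFrame o θ)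
  have hm : MeasurableSet (Set.univ.pi ![A, B]) := by
    refine MeasurableSet.univ_pi fun i => ?_
    fin_cases i
    exacts [hA, hB]
  have := h.measure_preimage hm.nullMeasurableSet
  rw [volume_pi_pi, Fin.prod_univ_two] at this
  refine Eq.trans ?_ this
  congr 1
  ext x
  simp [Fin.forall_fin_two]

lemma tiltedSquare_eq (o : Plane) (θ s : ℝ) :
    tiltedSquare o θ s = {x | planeFrame o θ x 0 ∈ Set.Icc (-(s / 2)) (s / 2) ∧
      planeFrame o θ x 1 ∈ Set.Icc (-(s / 2)) (s / 2)} := by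
  ext x
  simp only [tiltedSquare, Set.mem_ofPred_eq, Set.mem_Icc, planeFrame, planeRotation_zero,
    planeRotation_one, ← abs_le]
  rfl

lemma measurableSet_tiltedSquare (o : Plane) (θ s : ℝ) : MeasurableSet (tiltedSquare o θ s) := by
  rw [tiltedSquare_eq]
  exact measurableSet_planeFrame o θ measurableSet_Icc measurableSet_Icc

lemma volume_tiltedSquare_sqrt (o : Plane) (θ : ℝ) (M : ℕ) :
    volume (tiltedSquare o θ √M) = M := by
  rw [tiltedSquare_eq, volume_planeFrame o θ measurableSet_Icc measurableSet_Icc, Real.volume_Icc,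
    sub_neg_eq_add, add_halves, ← ENNReal.ofReal_mul (Real.sqrt_nonneg _),
    Real.mul_self_sqrt (Nat.cast_nonneg _), ENNReal.ofReal_natCast]

/-- The cells of the unit grid of an orthonormal frame. -/
def frameCell (o : Plane) (θ : ℝ) (i : ℤ × ℤ) : Set Plane :=
  {x | ⌊planeFrame o θ x 0⌋ = i.1 ∧ ⌊planeFrame o θ x 1⌋ = i.2}

lemma frameCell_eq (o : Plane) (θ : ℝ) (i : ℤ × ℤ) :
    frameCell o θ i = {x | planeFrame o θ x 0 ∈ Set.Ico (i.1 : ℝ) (i.1 + 1) ∧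
      planeFrame o θ x 1 ∈ Set.Ico (i.2 : ℝ) (i.2 + 1)} := by
  ext x
  simp only [frameCell, Set.mem_ofPred_eq, Int.floor_eq_iff, Set.mem_Ico]

lemma measurableSet_frameCell (o : Plane) (θ : ℝ) (i : ℤ × ℤ) :
    MeasurableSet (frameCell o θ i) := by
  rw [frameCell_eq]
  exact measurableSet_planeFrame o θ measurableSet_Ico measurableSet_Ico

lemma volume_frameCell (o : Plane) (θ : ℝ) (i : ℤ × ℤ) : volume (frameCell o θ i) = 1 := by
  rw [frameCell_eq, volume_planeFrame o θ measurableSet_Ico measurableSet_Ico, Real.volume_Ico,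
    Real.volume_Ico]
  simp

/-- The square may be tilted against the frame, so only the half diagonal `√M / √2` bounds a
coordinate, and `1 / √2 ≤ 3 / 4`. -/
lemma abs_planeFrame_le_of_mem_tiltedSquare {o : Plane} {θ : ℝ} {M : ℕ} {x : Plane}
    (hx : x ∈ tiltedSquare o θ √M) (α : ℝ) (i : Fin 2) : |planeFrame o α x i| ≤ 3 / 4 * √M := by
  have h1 : ‖planeFrame o α x‖ = ‖planeFrame o θ x‖ := by
    rw [planeFrame, planeFrame, LinearIsometryEquiv.norm_map, LinearIsometryEquiv.norm_map]
  rw [tiltedSquare_eq] at hx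
  have h2 : ‖planeFrame o θ x‖ ^ 2 ≤ √M ^ 2 / 2 := by
    rw [EuclideanSpace.real_norm_sq_eq, Fin.sum_univ_two]
    have e0 := sq_le_sq' hx.1.1 hx.1.2
    have e1 := sq_le_sq' hx.2.1 hx.2.2
    nlinarith
  have h3 : planeFrame o α x i ^ 2 ≤ ‖planeFrame o α x‖ ^ 2 := by
    rw [EuclideanSpace.real_norm_sq_eq]
    exact Finset.single_le_sum (f := fun i => planeFrame o α x i ^ 2) (fun _ _ => sq_nonneg _)
      (Finset.mem_univ i)
  rw [h1] at h3
  refine abs_le_of_sq_le_sq ?_ (by positivity)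
  nlinarith [sq_nonneg √M]

/-- The distance between two points in terms of their coordinates in parallel frames whose first
axis joins their origins. -/
lemma exists_dist_eq_planarRadius {o₁ o₂ : Plane} {d : ℝ} (hd : 0 < d) (h : dist o₁ o₂ = d) :
    ∃ α : ℝ, ∀ x y : Plane, dist x y = planarRadius (d + planeFrame o₁ α x 0 - planeFrame o₂ α y 0)
      (planeFrame o₁ α x 1 - planeFrame o₂ α y 1) := by
  set w := o₁ - o₂ with hw
  have hwn : w 0 ^ 2 + w 1 ^ 2 = d ^ 2 := by
    rw [← h, dist_eq_norm, EuclideanSpace.real_norm_sq_eq, Fin.sum_univ_two]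
  obtain ⟨α, hc, hs⟩ : ∃ α, w 0 = d * Real.cos α ∧ w 1 = d * Real.sin α := by
    set z : ℂ := ⟨w 0, w 1⟩ with hz
    have hzn : ‖z‖ = d := by
      rw [← sq_eq_sq₀ (norm_nonneg _) hd.le, ← Complex.normSq_eq_norm_sq, Complex.normSq_apply,
        ← hwn]
      ring
    refine ⟨z.arg, ?_, ?_⟩
    · rw [← hzn, Complex.norm_mul_cos_arg]
    · rw [← hzn, Complex.norm_mul_sin_arg]
  refine ⟨α, fun x y => ?_⟩
  have hxy : planeRotation α (x - y) = planeFrame o₁ α x - planeFrame o₂ α y + planeRotation α w := by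
    rw [planeFrame, planeFrame, ← map_sub, ← map_add]
    congr 1
    rw [hw]
    abel
  have h0 : planeRotation α w 0 = d := by
    rw [planeRotation_zero, hc, hs]
    linear_combination d * Real.sin_sq_add_cos_sq α
  have h1 : planeRotation α w 1 = 0 := by
    rw [planeRotation_one, hc, hs]
    ring
  rw [dist_eq_norm, ← LinearIsometryEquiv.norm_map (planeRotation α), hxy, planarRadius,
    EuclideanSpace.norm_eq, Fin.sum_univ_two]
  simp only [PiLp.add_apply, PiLp.sub_apply, h0, h1, Real.norm_eq_abs, sq_abs]
  congr 1
  ring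

/-! ### The norm for a fixed configuration of nodes -/

lemma spectralNormOf_sq_le {M : ℕ} {A : Matrix (Fin M) (Fin M) ℂ} {B : ℝ} (hB : 0 ≤ B)
    (h : ∀ v : Fin M → ℂ, ∑ j, ‖∑ k, v k * A j k‖ ^ 2 ≤ B * ∑ k, ‖v k‖ ^ 2) :
    spectralNormOf A ^ 2 ≤ B := by
  have : spectralNormOf A ≤ √B := by
    refine ContinuousLinearMap.opNorm_le_bound _ (Real.sqrt_nonneg _) fun v => ?_
    refine le_of_sq_le_sq ?_ (by positivity)
    rw [mul_pow, Real.sq_sqrt hB, EuclideanSpace.norm_sq_eq, EuclideanSpace.norm_sq_eq,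
      Matrix.ofLp_toEuclideanCLM]
    simpa only [Matrix.mulVec, dotProduct, mul_comm] using h v.ofLp
  calc _ ≤ √B ^ 2 := pow_le_pow_left₀ (norm_nonneg _) this 2
    _ = B := Real.sq_sqrt hB

/-- The norm of the line-of-sight matrix for a fixed configuration of nodes of which no cell of any
unit grid contains more than `m`. -/
lemma exists_spectralNormOf_losMatrix_sq_le :
    ∃ K : ℝ, 0 ≤ K ∧ ∀ (M : ℕ) (d : ℝ) (o₁ o₂ : Plane), 16 ≤ M → 2 * √M ≤ d → dist o₁ o₂ = d →
      ∃ (α : ℝ) (n : ℕ), (n : ℝ) ^ 2 ≤ M ∧ (∀ (o : Plane) (θ : ℝ), ∀ x ∈ tiltedSquare o θ √M,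
          ∃ i ∈ Finset.Ico (-n : ℤ) n ×ˢ Finset.Ico (-n : ℤ) n, x ∈ frameCell o α i) ∧
        ∀ (θ₁ θ₂ : ℝ) (x y : Fin M → Plane) (m : ℕ), (∀ j, x j ∈ tiltedSquare o₁ θ₁ √M) →
          (∀ k, y k ∈ tiltedSquare o₂ θ₂ √M) →
          (∀ (i : ℤ × ℤ) (s : Finset (Fin M)), (∀ j ∈ s, x j ∈ frameCell o₁ α i) → s.card ≤ m) →
          (∀ (i : ℤ × ℤ) (s : Finset (Fin M)), (∀ k ∈ s, y k ∈ frameCell o₂ α i) → s.card ≤ m) →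
          spectralNormOf (losMatrix x y) ^ 2 ≤ K * (M * m ^ 2 * (1 + Real.log M) / d) := by
  obtain ⟨K, hK, h⟩ := exists_sum_wave_le
  refine ⟨K, hK, fun M d o₁ o₂ hM hd hdist => ?_⟩
  -- With `r = 3 / 4 * √M` and `d ≥ 2 * √M`, both `2 * r + 1 ≤ 7 / 8 * d` and `n ≤ √M` follow from
  -- `√M ≥ 4`.
  have hL : (4 : ℝ) ≤ √M := Real.le_sqrt_of_sq_le (by
    have : (16 : ℝ) ≤ M := by exact_mod_cast hM
    linarith)
  have hLsq : √M ^ 2 = M := Real.sq_sqrt (Nat.cast_nonneg _)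
  have hd0 : 0 < d := by linarith
  obtain ⟨α, hα⟩ := exists_dist_eq_planarRadius hd0 hdist
  set n := ⌊3 / 4 * √M⌋₊ + 1 with hn
  have hrn : 3 / 4 * √M < n := by
    rw [hn]; push_cast; exact Nat.lt_floor_add_one _
  have hnL : (n : ℝ) ≤ √M := by
    have := Nat.floor_le (show 0 ≤ 3 / 4 * √M by positivity)
    rw [hn]; push_cast; linarith
  have hnM : (n : ℝ) ^ 2 ≤ M := by rw [← hLsq]; gcongr
  have hn2 : (2 * n : ℝ) ≤ M := by rw [← hLsq]; nlinarith
  have hn0 : (0 : ℝ) < n := by rw [hn]; positivity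
  -- The frame and the grid are fixed by the centres before the nodes are chosen, as the union bound
  -- over cells requires.
  refine ⟨α, n, hnM, fun o θ x hx => ?_, fun θ₁ θ₂ x y m hx hy hmx hmy => ?_⟩
  · refine ⟨(⌊planeFrame o α x 0⌋, ⌊planeFrame o α x 1⌋), ?_, rfl, rfl⟩
    have e0 := abs_le.1 (abs_planeFrame_le_of_mem_tiltedSquare hx α 0)
    have e1 := abs_le.1 (abs_planeFrame_le_of_mem_tiltedSquare hx α 1)
    simp only [Finset.mem_product, Finset.mem_Ico, Int.le_floor, Int.floor_lt]
    push_cast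
    refine ⟨⟨?_, ?_⟩, ?_, ?_⟩ <;> linarith
  · have hlog : Real.log (2 * n) ≤ Real.log M := Real.log_le_log (by positivity) hn2
    have hlog0 : 0 ≤ Real.log (2 * n) := by exact_mod_cast Real.log_natCast_nonneg (2 * n)
    refine spectralNormOf_sq_le (mul_nonneg hK (div_nonneg (mul_nonneg (by positivity)
      (by linarith)) hd0.le)) fun v => ?_
    have key := h (Fin M) (Fin M) Finset.univ Finset.univ (fun j => planeFrame o₁ α (x j) 0)
      (fun j => planeFrame o₁ α (x j) 1) (fun k => planeFrame o₂ α (y k) 0)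
      (fun k => planeFrame o₂ α (y k) 1) v d (3 / 4 * √M) n m (by linarith) (by linarith) hrn
      (by linarith)
      (fun j _ => ⟨abs_planeFrame_le_of_mem_tiltedSquare (hx j) α 0,
        abs_planeFrame_le_of_mem_tiltedSquare (hx j) α 1⟩)
      (fun k _ => ⟨abs_planeFrame_le_of_mem_tiltedSquare (hy k) α 0,
        abs_planeFrame_le_of_mem_tiltedSquare (hy k) α 1⟩)
      (fun i l => by refine hmx (i, l) _ fun j hj => ?_; exact (Finset.mem_filter.1 hj).2)
      (fun i l => by refine hmy (i, l) _ fun k hk => ?_; exact (Finset.mem_filter.1 hk).2)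
    refine le_trans (le_of_eq ?_) (key.trans ?_)
    · refine Finset.sum_congr rfl fun j _ => ?_
      congr 2
      refine Finset.sum_congr rfl fun k _ => ?_
      have e1 := abs_le.1 (abs_planeFrame_le_of_mem_tiltedSquare (hx j) α 0)
      have e2 := abs_le.1 (abs_planeFrame_le_of_mem_tiltedSquare (hy k) α 0)
      rw [wave_losAmp (by linarith), losMatrix, Matrix.of_apply, hα]
    · gcongr

/-! ### Occupancy of the cells and conclusion -/

/-- The probability that one of finitely many cells of small measure contains `N` of `M`
independent points. -/
lemma measureReal_occupancy_le {Ω E κ : Type*} [MeasurableSpace Ω] [MeasurableSpace E]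
    {P : Measure Ω} [IsProbabilityMeasure P] {M : ℕ} (hM : 1 ≤ M) {X : Fin M → Ω → E}
    (hX : iIndepFun X P) (T : Finset κ) {A : κ → Set E} (hA : ∀ c, MeasurableSet (A c))
    (hXA : ∀ j c, P.real (X j ⁻¹' A c) ≤ (M : ℝ)⁻¹) (N : ℕ) :
    P.real (⋃ c ∈ T, ⋃ s ∈ Finset.powersetCard N (Finset.univ : Finset (Fin M)),
      ⋂ j ∈ s, X j ⁻¹' A c) ≤ T.card / N.factorial := by
  have hM0 : (M : ℝ) ≠ 0 := by exact_mod_cast (by omega : M ≠ 0)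
  have h1 : ∀ c, ∀ s ∈ Finset.powersetCard N (Finset.univ : Finset (Fin M)),
      P.real (⋂ j ∈ s, X j ⁻¹' A c) ≤ (M : ℝ)⁻¹ ^ N := fun c s hs => by
    rw [measureReal_def, hX.measure_inter_preimage_eq_mul s fun _ _ => hA c, ENNReal.toReal_prod,
      ← (Finset.mem_powersetCard.1 hs).2, ← Finset.prod_const]
    exact Finset.prod_le_prod (fun _ _ => ENNReal.toReal_nonneg) fun j _ => hXA j c
  -- There are at most `M ^ N / N!` sets of `N` nodes, which cancels the probability `M ^ (-N)` of
  -- each up to `1 / N!`.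
  have h2 : ∀ c, P.real (⋃ s ∈ Finset.powersetCard N (Finset.univ : Finset (Fin M)),
      ⋂ j ∈ s, X j ⁻¹' A c) ≤ 1 / N.factorial := fun c => by
    calc _ ≤ ∑ s ∈ Finset.powersetCard N (Finset.univ : Finset (Fin M)), (M : ℝ)⁻¹ ^ N :=
          (measureReal_biUnion_finset_le _ _).trans (Finset.sum_le_sum (h1 c))
      _ = M.choose N * (M : ℝ)⁻¹ ^ N := by
          rw [Finset.sum_const, Finset.card_powersetCard, Finset.card_univ, Fintype.card_fin,
            nsmul_eq_mul]
      _ ≤ M ^ N / N.factorial * (M : ℝ)⁻¹ ^ N := by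
          gcongr
          exact Nat.choose_le_pow_div N M
      _ = _ := by rw [inv_pow]; field_simp
  calc _ ≤ ∑ c ∈ T, (1 / N.factorial : ℝ) :=
        (measureReal_biUnion_finset_le _ _).trans (Finset.sum_le_sum fun c _ => h2 c)
    _ = _ := by rw [Finset.sum_const, nsmul_eq_mul]; ring

/-- Outside an event of small probability, all nodes of a uniform cluster lie in its square, and
no cell of the unit grid contains more than `m` of them. -/
lemma exists_event_occupancy {Ω : Type*} [MeasurableSpace Ω] {P : Measure Ω}
    [IsProbabilityMeasure P] {M : ℕ} (hM : 1 ≤ M) {X : Fin M → Ω → Plane} (hX : iIndepFun X P)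
    {o : Plane} {θ : ℝ} (hU : ∀ j, pdf.IsUniform (X j) (tiltedSquare o θ √M) P volume) (α : ℝ)
    (T : Finset (ℤ × ℤ)) (hT : ∀ x ∈ tiltedSquare o θ √M, ∃ i ∈ T, x ∈ frameCell o α i) (m : ℕ) :
    ∃ Z : Set Ω, P.real Z ≤ T.card / (m + 1).factorial ∧ ∀ ω ∉ Z,
      (∀ j, X j ω ∈ tiltedSquare o θ √M) ∧
        ∀ (i : ℤ × ℤ) (s : Finset (Fin M)), (∀ j ∈ s, X j ω ∈ frameCell o α i) → s.card ≤ m := by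
  set Q := tiltedSquare o θ √M with hQ
  have hM0 : M ≠ 0 := by omega
  have hvol : volume Q = M := volume_tiltedSquare_sqrt o θ M
  have hpre : ∀ j {A : Set Plane}, MeasurableSet A →
      P.real (X j ⁻¹' A) = (volume (Q ∩ A)).toReal / M := fun j A hA => by
    rw [measureReal_def, (hU j).measure_preimage (by rw [hvol]; exact_mod_cast hM0)
      (by rw [hvol]; exact ENNReal.natCast_ne_top M) hA, hvol, ENNReal.toReal_div,
      ENNReal.toReal_natCast]
  set Z₁ := ⋃ c ∈ T, ⋃ s ∈ Finset.powersetCard (m + 1) (Finset.univ : Finset (Fin M)),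
      ⋂ j ∈ s, X j ⁻¹' frameCell o α c with hZ₁
  set Z₂ := ⋃ j ∈ (Finset.univ : Finset (Fin M)), X j ⁻¹' Qᶜ with hZ₂
  have h1 : P.real Z₁ ≤ T.card / (m + 1).factorial := by
    refine measureReal_occupancy_le hM hX T (fun c => measurableSet_frameCell o α c)
      (fun j c => ?_) (m + 1)
    rw [hpre j (measurableSet_frameCell o α c), ← one_div]
    gcongr
    refine ENNReal.toReal_le_of_le_ofReal zero_le_one ?_
    rw [ENNReal.ofReal_one, ← volume_frameCell o α c]
    exact measure_mono Set.inter_subset_right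
  have h2 : P.real Z₂ ≤ 0 := by
    refine (measureReal_biUnion_finset_le _ _).trans (Finset.sum_nonpos fun j _ => ?_)
    rw [hpre j (measurableSet_tiltedSquare o θ _).compl, Set.inter_compl_self]
    simp
  refine ⟨Z₁ ∪ Z₂, (measureReal_union_le _ _).trans (by linarith), fun ω hω => ?_⟩
  rw [Set.mem_union, not_or] at hω
  have hin : ∀ j, X j ω ∈ Q := fun j => by
    by_contra hj
    exact hω.2 (Set.mem_biUnion (Finset.mem_univ j) hj)
  refine ⟨hin, fun i s hs => ?_⟩
  by_contra! hcard
  obtain ⟨s', hs', hs'c⟩ := Finset.exists_subset_card_eq (Nat.succ_le_of_lt hcard)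
  obtain ⟨j, hj⟩ : s.Nonempty := Finset.card_pos.1 (by omega)
  -- An overfull cell contains a point of the square, so it is one of the cells in `T`.
  obtain ⟨i', hi', hji'⟩ := hT _ (hin j)
  have hii : i' = i := Prod.ext (hji'.1.symm.trans (hs j hj).1) (hji'.2.symm.trans (hs j hj).2)
  refine hω.1 (Set.mem_biUnion (hii ▸ hi') (Set.mem_biUnion (x := s')
    (Finset.mem_powersetCard.2 ⟨Finset.subset_univ _, hs'c⟩) ?_))
  exact Set.mem_iInter₂.2 fun j hj => hs j (hs' hj)

/-- Both `exp m / m! ≤ exp (exp 1)` and `m ^ N / N! ≤ exp m` compare one term of an exponential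
series with its sum; their product makes `1 / m!` smaller than any power of `1 / m`. -/
lemma inv_factorial_le (m N : ℕ) (hm : 1 ≤ m) :
    ((m.factorial : ℝ))⁻¹ ≤ Real.exp (Real.exp 1) * N.factorial / m ^ N := by
  have h1 := Real.pow_div_factorial_le_exp (Real.exp 1) (Real.exp_pos 1).le m
  have h2 := Real.pow_div_factorial_le_exp m (Nat.cast_nonneg m) N
  rw [Real.exp_one_pow] at h1
  have hm0 : (0 : ℝ) < m := by exact_mod_cast hm
  rw [le_div_iff₀ (by positivity)]
  rw [div_le_iff₀ (by positivity)] at h2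
  calc (m.factorial : ℝ)⁻¹ * m ^ N ≤ (m.factorial : ℝ)⁻¹ * (Real.exp m * N.factorial) := by gcongr
    _ = Real.exp m / m.factorial * N.factorial := by ring
    _ ≤ _ := by gcongr

theorem mainTheorem4 :
    ∀ ε : ℝ, 0 < ε → ∃ c : ℝ, 0 < c ∧
      ∀ p : ℝ, 0 < p → ∃ C : ℝ, 0 < C ∧
        ∀ (M : ℕ) (d : ℝ), 1 ≤ M → 2 * Real.sqrt M ≤ d → d ≤ M →
        ∀ (o₁ o₂ : Plane) (θ₁ θ₂ : ℝ), dist o₁ o₂ = d →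
        ∀ (Ω : Type*) [MeasurableSpace Ω] (P : Measure Ω) [IsProbabilityMeasure P]
          (X Y : Fin M → Ω → Plane), IsUniformClusterPair P M o₁ o₂ θ₁ θ₂ X Y →
          1 - C * (M : ℝ) ^ (-p) ≤
            P.real {ω | spectralNormOf (losMatrix (fun j => X j ω) (fun k => Y k ω)) ^ 2 ≤
              c * ((M : ℝ) ^ (1 + ε) / d)} := by
  intro ε hε
  obtain ⟨K, hK, hdet⟩ := exists_spectralNormOf_losMatrix_sq_le
  -- The `4` comes from `m² ≤ 4 * M ^ (ε / 2)` and `1 + 2 / ε` from bounding `1 + log M` by a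
  -- multiple of `M ^ (ε / 2)`. The final `1` ensures positivity when `K = 0`.
  refine ⟨4 * K * (1 + 2 / ε) + 1, by positivity, fun p hp => ?_⟩
  -- This gives `m ^ N ≥ M ^ (p + 1)`; the extra power of `M` pays for the at most `4 * M` cells.
  set N := ⌈(p + 1) / (ε / 4)⌉₊ with hN
  -- The term `16 ^ p` makes the claim trivial for `M < 16`; `8` is two clusters times the `4` from
  -- the number of cells.
  refine ⟨16 ^ p + 8 * (Real.exp (Real.exp 1) * N.factorial), by positivity, ?_⟩
  intro M d hM hd hdM o₁ o₂ θ₁ θ₂ hdist Ω _ P _ X Y hXY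
  have hM1 : (1 : ℝ) ≤ M := by exact_mod_cast hM
  have hM0 : (0 : ℝ) < M := by linarith
  have hd0 : 0 < d := lt_of_lt_of_le (by positivity) hd
  have hMp : (0 : ℝ) < (M : ℝ) ^ (-p) := by positivity
  rcases lt_or_ge M 16 with hsmall | hlarge
  · have h1 : 1 ≤ (16 : ℝ) ^ p * (M : ℝ) ^ (-p) := by
      rw [Real.rpow_neg hM0.le, ← div_eq_mul_inv, one_le_div (by positivity)]
      exact Real.rpow_le_rpow hM0.le (by exact_mod_cast hsmall.le) hp.le
    have h2 : 0 ≤ 8 * (Real.exp (Real.exp 1) * N.factorial) * (M : ℝ) ^ (-p) := by positivity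
    refine le_trans ?_ measureReal_nonneg
    linarith
  obtain ⟨α, n, hnM, hcover, hnorm⟩ := hdet M d o₁ o₂ hlarge hd hdist
  set T := Finset.Ico (-n : ℤ) n ×ˢ Finset.Ico (-n : ℤ) n with hT
  have hTc : (T.card : ℝ) ≤ 4 * M := by
    have : T.card = 4 * n ^ 2 := by
      rw [hT, Finset.card_product, Int.card_Ico, show ((n : ℤ) - -n).toNat = 2 * n by omega]
      ring
    rw [this]
    push_cast
    linarith
  set m := ⌈(M : ℝ) ^ (ε / 4)⌉₊ with hm
  have hmlow : (M : ℝ) ^ (ε / 4) ≤ m := Nat.le_ceil _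
  have hMe : 1 ≤ (M : ℝ) ^ (ε / 4) := Real.one_le_rpow hM1 (by positivity)
  have hmup : (m : ℝ) ≤ 2 * (M : ℝ) ^ (ε / 4) := by
    linarith [Nat.ceil_lt_add_one (show 0 ≤ (M : ℝ) ^ (ε / 4) by positivity)]
  have hm1 : 1 ≤ m := by exact_mod_cast hMe.trans hmlow
  have hindX : iIndepFun X P := hXY.indep.precomp (g := Sum.inl) Sum.inl_injective
  have hindY : iIndepFun Y P := hXY.indep.precomp (g := Sum.inr) Sum.inr_injective
  obtain ⟨Z₁, hZ₁, hgX⟩ := exists_event_occupancy hM hindX hXY.uniform_fst α T (hcover o₁ θ₁) m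
  obtain ⟨Z₂, hZ₂, hgY⟩ := exists_event_occupancy hM hindY hXY.uniform_snd α T (hcover o₂ θ₂) m
  set G := {ω | spectralNormOf (losMatrix (fun j => X j ω) (fun k => Y k ω)) ^ 2 ≤
    (4 * K * (1 + 2 / ε) + 1) * ((M : ℝ) ^ (1 + ε) / d)} with hG
  have hnum : K * (M * m ^ 2 * (1 + Real.log M) / d) ≤
      (4 * K * (1 + 2 / ε) + 1) * ((M : ℝ) ^ (1 + ε) / d) := by
    have e1 : (m : ℝ) ^ 2 ≤ 4 * (M : ℝ) ^ (ε / 2) := by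
      calc (m : ℝ) ^ 2 ≤ (2 * (M : ℝ) ^ (ε / 4)) ^ 2 := by gcongr
        _ = 4 * ((M : ℝ) ^ (ε / 4) * (M : ℝ) ^ (ε / 4)) := by ring
        _ = 4 * (M : ℝ) ^ (ε / 2) := by rw [← Real.rpow_add hM0]; ring_nf
    have e2 : 1 + Real.log M ≤ (1 + 2 / ε) * (M : ℝ) ^ (ε / 2) := by
      have h1 := Real.log_le_rpow_div hM0.le (half_pos hε)
      have h2 : 1 ≤ (M : ℝ) ^ (ε / 2) := Real.one_le_rpow hM1 (by positivity)
      have h3 : (M : ℝ) ^ (ε / 2) / (ε / 2) = 2 / ε * (M : ℝ) ^ (ε / 2) := by field_simp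
      linarith
    have e3 : (M : ℝ) ^ (1 + ε) = M * ((M : ℝ) ^ (ε / 2) * (M : ℝ) ^ (ε / 2)) := by
      rw [← Real.rpow_add hM0, add_halves, Real.rpow_add hM0, Real.rpow_one]
    have e4 : 0 ≤ 1 + Real.log M := by linarith [Real.log_nonneg hM1]
    calc _ ≤ K * (M * (4 * (M : ℝ) ^ (ε / 2)) * ((1 + 2 / ε) * (M : ℝ) ^ (ε / 2)) / d) := by
          gcongr
      _ = 4 * K * (1 + 2 / ε) * ((M : ℝ) ^ (1 + ε) / d) := by rw [e3]; ring
      _ ≤ _ := by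
          gcongr
          linarith
  have hcov : (Set.univ : Set Ω) ⊆ G ∪ (Z₁ ∪ Z₂) := fun ω _ => by
    by_cases h1 : ω ∈ Z₁
    · exact Or.inr (Or.inl h1)
    by_cases h2 : ω ∈ Z₂
    · exact Or.inr (Or.inr h2)
    exact Or.inl ((hnorm θ₁ θ₂ _ _ m (hgX ω h1).1 (hgY ω h2).1 (hgX ω h1).2 (hgY ω h2).2).trans hnum)
  -- Only monotonicity and subadditivity enter, so `G` need not be shown measurable.
  have hprob : 1 ≤ P.real G + (P.real Z₁ + P.real Z₂) := by
    calc (1 : ℝ) = P.real Set.univ := probReal_univ.symm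
      _ ≤ P.real (G ∪ (Z₁ ∪ Z₂)) := measureReal_mono hcov
      _ ≤ _ := (measureReal_union_le _ _).trans (by gcongr; exact measureReal_union_le _ _)
  have hfac : (T.card : ℝ) / (m + 1).factorial ≤
      4 * (Real.exp (Real.exp 1) * N.factorial) * (M : ℝ) ^ (-p) := by
    have f1 : (M : ℝ) ^ (p + 1) ≤ (m : ℝ) ^ N := by
      calc (M : ℝ) ^ (p + 1) ≤ (M : ℝ) ^ (ε / 4 * N) := by
            refine Real.rpow_le_rpow_of_exponent_le hM1 ?_
            have := Nat.le_ceil ((p + 1) / (ε / 4))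
            rw [div_le_iff₀ (by positivity)] at this
            rw [hN]
            linarith
        _ = ((M : ℝ) ^ (ε / 4)) ^ N := by rw [Real.rpow_mul hM0.le, Real.rpow_natCast]
        _ ≤ _ := by gcongr
    calc (T.card : ℝ) / (m + 1).factorial ≤ 4 * M / m.factorial := by
          gcongr
          omega
      _ = 4 * M * (m.factorial : ℝ)⁻¹ := div_eq_mul_inv _ _
      _ ≤ 4 * M * (Real.exp (Real.exp 1) * N.factorial / m ^ N) := by
          gcongr
          exact inv_factorial_le m N hm1
      _ ≤ 4 * M * (Real.exp (Real.exp 1) * N.factorial / (M : ℝ) ^ (p + 1)) := by gcongr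
      _ = _ := by
          rw [Real.rpow_add hM0, Real.rpow_one, Real.rpow_neg hM0.le]
          field_simp
  have h16 : 0 ≤ (16 : ℝ) ^ p * (M : ℝ) ^ (-p) := by positivity
  linarith
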